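/- Let $\mathbb F\in\{\mathbb R,\mathbb C,\mathbb H\}$ and let $q\ge 1$ be an integer. Write $M_{p,q}$ for the $p\times q$ matrices over $\mathbb F$, $U_p$ for the group of unitary $p\times p$ matrices over $\mathbb F$, $H_q$ for the Hermitian $q\times q$ matrices over $\mathbb F$, $\Pi_q=\{x^2: x\in H_q\}$ for the cone of positive semidefinite matrices, and $\langle x,y\rangle=\operatorname{Re}\operatorname{tr}(xy)$ for $x,y\in H_q$. Let $G_p=M_{p,q}\rtimes U_p$, where $U_p$ acts by left multiplication, and $K_p=U_p$; embed $G_p$ in $G_{p+1}$ by $(x,k)\mapsto\left(\begin{pmatrix}x\\0\end{pmatrix},\begin{pmatrix}k&0\\0&1\end{pmatrix}\right)$. Let $G_\infty=\varinjlim G_p=M_{\infty,q}\rtimes U_\infty$, with the inductive limit topology, and $K_\infty=\varinjlim K_p=U_\infty$. An Olshanski spherical function of $(G_\infty,K_\infty)$ is a continuous $K_\infty$-biinvariant function $\phi:G_\infty\to\mathbb C$, not identically zero, such that $$\phi(g)\phi(h)=\lim_{p\to\infty}\int_{K_p}\phi(gkh)\,dk\qquad\text{for all } g,h\in G_\infty,$$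 where $dk$ is the normalized Haar measure of $K_p$. It is positive definite if $\sum_{k,l=1}^n c_k\overline{c_l}\,\phi(g_kg_l^{-1})\ge 0$ for all $n\in\mathbb N$, $g_1,\dots,g_n\in G_\infty$ and $c_1,\dots,c_n\in\mathbb C$. For $a\in\Pi_q$ let $g_a=\left(\begin{pmatrix}a\\0\end{pmatrix},I\right)\in G_\infty$. A continuous $K_\infty$-biinvariant function $\phi$ on $G_\infty$ is identified with the function $a\mapsto\phi(g_a)$ on $\Pi_q$. Theorem. Under this identification, the positive definite Olshanski spherical functions of $(G_\infty,K_\infty)$ are precisely the functions $$\psi_b(a)=\exp\bigl(-\langle a^2,b\rangle\bigr),\qquad a\in\Pi_q,$$ with $b\in\Pi_q$. That is: a function $\phi:G_\infty\to\mathbb C$ is a positive definite Olshanski spherical function if and only if it is continuous and $K_\infty$-biinvariant and there is a $b\in\Pi_q$ with $\phi(g_a)=\psi_b(a)$ for all $a\in\Pi_q$; and for every $b\in\Pi_q$ there is exactly one continuous $K_\infty$-biinvariant function $\phi$ on $G_\infty$ with $\phi(g_a)=\psi_b(a)$ for all $a\in\Pi_q$. -/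

import Mathlib

noncomputable section

open MeasureTheory Filter Topology

set_option linter.unusedSectionVars false

namespace OlshanskiMotion

/-- Data shared by the three classical fields `ℝ`, `ℂ`, `ℍ` (it is instantiated below exactly for
these): the real part `re t = (t + star t) / 2`, the identity `star t * t = ‖t‖ ^ 2`, and finite
dimension over `ℝ`. -/
class ClassicalField (F : Type) [NormedDivisionRing F] [StarRing F] [NormedAlgebra ℝ F] where
  re : F → ℝ
  algebraMap_re : ∀ t : F, algebraMap ℝ F (re t) = (2 : ℝ)⁻¹ • (t + star t)
  star_mul_self_eq : ∀ t : F, star t * t = algebraMap ℝ F (‖t‖ ^ 2)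
  finiteDimensional : FiniteDimensional ℝ F

instance : ClassicalField ℝ where
  re t := t
  algebraMap_re t := by simp; ring
  star_mul_self_eq t := by simp [pow_two]
  finiteDimensional := inferInstance

instance : ClassicalField ℂ where
  re t := t.re
  algebraMap_re t := by
    apply Complex.ext <;> simp
    ring
  star_mul_self_eq t := by
    have := Complex.conj_mul' t
    simpa using this
  finiteDimensional := inferInstance

instance : ClassicalField (Quaternion ℝ) where
  re t := t.re
  algebraMap_re t := by
    apply Quaternion.ext <;> simp [Quaternion.algebraMap_def]
    ring
  star_mul_self_eq t := by
    rw [Quaternion.star_mul_self, Quaternion.normSq_eq_norm_mul_self, pow_two]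
    rfl
  finiteDimensional := inferInstance

variable (F : Type) [NormedDivisionRing F] [StarRing F] [NormedAlgebra ℝ F] [CStarRing F]

/-- The group `U_p = U_p(F)` of unitary `p × p` matrices over `F`. -/
abbrev U (p : ℕ) : Type := unitary (Matrix (Fin p) (Fin p) F)

instance (p : ℕ) : MeasurableSpace (U F p) := borel _

instance (p : ℕ) : BorelSpace (U F p) := ⟨rfl⟩

section compact

variable {F} [ClassicalField F]

theorem norm_entry_le {p : ℕ} (k : U F p) (i j : Fin p) : ‖k.1 i j‖ ≤ 1 := by
  have h := congrFun (congrFun (Unitary.coe_star_mul_self k) j) j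
  rw [Matrix.mul_apply] at h
  simp only [Matrix.star_apply, ClassicalField.star_mul_self_eq, Matrix.one_apply_eq] at h
  rw [← map_sum, ← map_one (algebraMap ℝ F)] at h
  have h' := (algebraMap ℝ F).injective h
  have h2 : ‖k.1 i j‖ ^ 2 ≤ ∑ x, ‖k.1 x j‖ ^ 2 :=
    Finset.single_le_sum (f := fun x => ‖k.1 x j‖ ^ 2)
      (fun x _ => sq_nonneg _) (Finset.mem_univ i)
  nlinarith [norm_nonneg (k.1 i j)]

instance (p : ℕ) : CompactSpace (U F p) := by
  have : FiniteDimensional ℝ F := ClassicalField.finiteDimensional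
  have : ProperSpace F := FiniteDimensional.proper ℝ F
  have hc : IsCompact (Set.pi Set.univ fun _ : Fin p => Set.pi Set.univ fun _ : Fin p =>
      Metric.closedBall (0 : F) 1) :=
    isCompact_univ_pi fun _ => isCompact_univ_pi fun _ => isCompact_closedBall _ _
  have hu : IsCompact (unitary (Matrix (Fin p) (Fin p) F) : Set (Matrix (Fin p) (Fin p) F)) := by
    refine IsCompact.of_isClosed_subset
      (s := (Set.pi Set.univ fun _ : Fin p => Set.pi Set.univ fun _ : Fin p =>
        Metric.closedBall (0 : F) 1 : Set (Matrix (Fin p) (Fin p) F))) hc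
      (isClosed_unitary (R := Matrix (Fin p) (Fin p) F)) ?_
    intro k hk i _ j _
    rw [mem_closedBall_zero_iff]
    exact norm_entry_le ⟨k, hk⟩ i j
  exact isCompact_iff_compactSpace.mp hu

end compact

/-- The normalized Haar measure on the compact group `U_p`. -/
def haarU [ClassicalField F] (p : ℕ) : Measure (U F p) := Measure.haarMeasure ⊤

/-- The action of `U_p` on the additive group `M_{p,q}` by left multiplication. -/
def leftAction (p q : ℕ) : U F p →* MulAut (Multiplicative (Matrix (Fin p) (Fin q) F)) where
  toFun k :=
    { toFun := fun x => .ofAdd (k.1 * x.toAdd)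
      invFun := fun x => .ofAdd (k⁻¹.1 * x.toAdd)
      left_inv := fun x => by
        change Multiplicative.ofAdd (k⁻¹.1 * (k.1 * x.toAdd)) = x
        rw [← Matrix.mul_assoc, ← Submonoid.coe_mul, inv_mul_cancel, Submonoid.coe_one,
          Matrix.one_mul, ofAdd_toAdd]
      right_inv := fun x => by
        change Multiplicative.ofAdd (k.1 * (k⁻¹.1 * x.toAdd)) = x
        rw [← Matrix.mul_assoc, ← Submonoid.coe_mul, mul_inv_cancel, Submonoid.coe_one,
          Matrix.one_mul, ofAdd_toAdd]
      map_mul' := fun x y => by rw [toAdd_mul, Matrix.mul_add, ofAdd_add] }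
  map_one' := by
    apply MulEquiv.ext
    intro x
    exact congrArg Multiplicative.ofAdd (Matrix.one_mul x.toAdd)
  map_mul' k l := by
    apply MulEquiv.ext
    intro x
    exact congrArg Multiplicative.ofAdd (Matrix.mul_assoc k.1 l.1 x.toAdd)

/-- The motion group `G_p = M_{p,q} ⋊ U_p`, with `(x, k) (y, l) = (x + k y, k l)`. -/
abbrev G (q p : ℕ) : Type :=
  Multiplicative (Matrix (Fin p) (Fin q) F) ⋊[leftAction F p q] U F p

/-- The topology of `G_p` as the product of the spaces `M_{p,q}` and `U_p`. -/
instance (q p : ℕ) : TopologicalSpace (G F q p) :=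
  TopologicalSpace.induced (fun g => (g.left, g.right)) inferInstance

section embedding

variable {F}

/-- Extension of a `m × q` matrix by zero rows. -/
def padRows {q m : ℕ} (n : ℕ) (x : Matrix (Fin m) (Fin q) F) : Matrix (Fin n) (Fin q) F :=
  Matrix.of fun i j => if h : i.val < m then x ⟨i, h⟩ j else 0

/-- Extension of a square matrix `k` to the block matrix `diag(k, I)`. -/
def padOne {m : ℕ} (n : ℕ) (k : Matrix (Fin m) (Fin m) F) : Matrix (Fin n) (Fin n) F :=
  Matrix.of fun i j =>
    if h : i.val < m ∧ j.val < m then k ⟨i, h.1⟩ ⟨j, h.2⟩ else if i = j then 1 else 0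

theorem padOne_one {m : ℕ} (n : ℕ) : padOne n (1 : Matrix (Fin m) (Fin m) F) = 1 := by
  ext i j
  simp only [padOne, Matrix.of_apply, Matrix.one_apply]
  split_ifs with h h1 h2 <;> simp_all [Fin.ext_iff]

theorem padOne_star {m : ℕ} (n : ℕ) (k : Matrix (Fin m) (Fin m) F) :
    padOne n (star k) = star (padOne n k) := by
  ext i j
  simp only [padOne, Matrix.of_apply, Matrix.star_apply, and_comm (a := i.val < m),
    eq_comm (a := i)]
  split_ifs <;> simp

theorem padOne_mul {m n : ℕ} (h : m ≤ n) (k l : Matrix (Fin m) (Fin m) F) :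
    padOne n (k * l) = padOne n k * padOne n l := by
  obtain ⟨d, rfl⟩ := Nat.exists_eq_add_of_le h
  ext i j
  rw [Matrix.mul_apply, Fin.sum_univ_add]
  have e1 : ∀ a b : Fin m, padOne (m + d) k (Fin.castAdd d a) (Fin.castAdd d b) = k a b ∧
      padOne (m + d) l (Fin.castAdd d a) (Fin.castAdd d b) = l a b ∧
      padOne (m + d) (k * l) (Fin.castAdd d a) (Fin.castAdd d b) = (k * l) a b := by
    intro a b; simp [padOne]
  have e2 : ∀ (x : Matrix (Fin m) (Fin m) F) (a : Fin m) (b : Fin d),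
      padOne (m + d) x (Fin.castAdd d a) (Fin.natAdd m b) = 0 := by
    intro x a b
    have : a.val ≠ m + b.val := by omega
    simp [padOne, Fin.ext_iff, this]
  have e3 : ∀ (x : Matrix (Fin m) (Fin m) F) (b : Fin d) (a : Fin m),
      padOne (m + d) x (Fin.natAdd m b) (Fin.castAdd d a) = 0 := by
    intro x b a
    have : m + b.val ≠ a.val := by omega
    simp [padOne, Fin.ext_iff, this]
  have e4 : ∀ (x : Matrix (Fin m) (Fin m) F) (a b : Fin d),
      padOne (m + d) x (Fin.natAdd m a) (Fin.natAdd m b) = if a = b then 1 else 0 := by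
    intro x a b; simp [padOne]
  refine Fin.addCases (fun i => ?_) (fun i => ?_) i <;>
  refine Fin.addCases (fun j => ?_) (fun j => ?_) j <;>
  simp [e1, e2, e3, e4, Matrix.mul_apply]

theorem padRows_mul {q m n : ℕ} (h : m ≤ n) (k : Matrix (Fin m) (Fin m) F)
    (x : Matrix (Fin m) (Fin q) F) :
    padRows n (k * x) = padOne n k * padRows n x := by
  obtain ⟨d, rfl⟩ := Nat.exists_eq_add_of_le h
  ext i j
  rw [Matrix.mul_apply, Fin.sum_univ_add]
  refine Fin.addCases (fun i => ?_) (fun i => ?_) i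
  · simp [padOne, padRows, Matrix.mul_apply]
  · have : ∀ a : Fin m, m + i.val ≠ a.val := by intro a; omega
    simp [padOne, padRows, Fin.ext_iff, this]

theorem padRows_add {q m : ℕ} (n : ℕ) (x y : Matrix (Fin m) (Fin q) F) :
    padRows n (x + y) = padRows n x + padRows n y := by
  ext i j
  simp only [padRows, Matrix.of_apply, Matrix.add_apply]
  split_ifs <;> simp

/-- The embedding `U_m → U_n`, `k ↦ diag(k, I)`. -/
def embU {m n : ℕ} (h : m ≤ n) : U F m →* U F n where
  toFun k := ⟨padOne n k.1, by
    rw [Unitary.mem_iff]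
    constructor
    · rw [← padOne_star, ← padOne_mul h, (Unitary.mem_iff.mp k.2).1, padOne_one]
    · rw [← padOne_star, ← padOne_mul h, (Unitary.mem_iff.mp k.2).2, padOne_one]⟩
  map_one' := Subtype.ext (padOne_one n)
  map_mul' k l := Subtype.ext (padOne_mul h k.1 l.1)

/-- The embedding `M_{m,q} → M_{n,q}` by zero rows, written multiplicatively. -/
def embM (q : ℕ) {m n : ℕ} (_h : m ≤ n) :
    Multiplicative (Matrix (Fin m) (Fin q) F) →* Multiplicative (Matrix (Fin n) (Fin q) F) where
  toFun x := .ofAdd (padRows n x.toAdd)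
  map_one' := by
    apply Multiplicative.toAdd.injective
    ext i j
    simp [padRows]
  map_mul' x y := by rw [toAdd_mul, padRows_add, ofAdd_add]

end embedding

/-- The embedding `G_m → G_n`, `(x, k) ↦ ((x; 0), diag(k, I))`, for `m ≤ n`. -/
def emb (q m n : ℕ) (h : m ≤ n) : G F q m →* G F q n :=
  SemidirectProduct.map (embM q h) (embU h) fun k => by
    apply MonoidHom.ext
    intro x
    exact congrArg Multiplicative.ofAdd (padRows_mul h k.1 x.toAdd)

instance (q : ℕ) : DirectedSystem (G F q) (fun i j h => emb F q i j h) where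
  map_self i g := by
    refine SemidirectProduct.ext ?_ (Subtype.ext ?_)
    · apply Multiplicative.toAdd.injective
      ext a b
      simp [emb, embM, padRows]
    · ext a b
      simp [emb, embU, padOne]
  map_map i j k hij hjk g := by
    refine SemidirectProduct.ext ?_ (Subtype.ext ?_)
    · apply Multiplicative.toAdd.injective
      ext a b
      simp only [emb, embM, padRows, SemidirectProduct.map_left, MonoidHom.coe_mk, OneHom.coe_mk,
        toAdd_ofAdd, Matrix.of_apply]
      split_ifs <;> first | rfl | omega
    · ext a b
      simp only [emb, embU, padOne, SemidirectProduct.map_right, MonoidHom.coe_mk, OneHom.coe_mk,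
        Matrix.of_apply, Fin.ext_iff]
      split_ifs <;> first | rfl | omega

/-- The inductive limit `G_∞ = M_{∞,q} ⋊ U_∞` of the groups `G_p`. -/
abbrev GInf (q : ℕ) : Type := DirectLimit (G F q) (emb F q)

/-- The canonical map `G_p → G_∞`. -/
def toGInf (q p : ℕ) (g : G F q p) : GInf F q := ⟦⟨p, g⟩⟧

/-- The inductive limit topology: the finest topology for which all `G_p → G_∞` are continuous. -/
instance (q : ℕ) : TopologicalSpace (GInf F q) :=
  ⨆ p, TopologicalSpace.coinduced (toGInf F q p) inferInstance

/-- A unitary matrix `k ∈ U_p`, as the element `(0, k)` of `G_∞`. -/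
def ofU (q p : ℕ) (k : U F p) : GInf F q := toGInf F q p (SemidirectProduct.inr k)

/-- The subgroup `K_∞ = U_∞` of `G_∞`, the union of the groups `U_p`. -/
def KInf (q : ℕ) : Set (GInf F q) := {g | ∃ (p : ℕ) (k : U F p), g = ofU F q p k}

variable {F}

/-- `φ : G_∞ → ℂ` is `K_∞`-biinvariant. -/
def IsBiinvariant {q : ℕ} (φ : GInf F q → ℂ) : Prop :=
  ∀ k ∈ KInf F q, ∀ l ∈ KInf F q, ∀ g, φ (k * g * l) = φ g

/-- Olshanski spherical functions of `(G_∞, K_∞)`: nonzero continuous `K_∞`-biinvariant functions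
with `φ g * φ h = lim_p ∫_{K_p} φ (g k h) dk`. -/
structure IsOlshanskiSpherical [ClassicalField F] {q : ℕ} (φ : GInf F q → ℂ) : Prop where
  ne_zero : φ ≠ 0
  continuous : Continuous φ
  biinvariant : IsBiinvariant φ
  product_formula : ∀ g h : GInf F q,
    Tendsto (fun p : ℕ => ∫ k : U F p, φ (g * ofU F q p k * h) ∂(haarU F p)) atTop
      (𝓝 (φ g * φ h))

open scoped ComplexOrder in
/-- Positive definite functions on a group; `0 ≤ z` in `ℂ` means that `z` is real and
nonnegative. -/
def IsPositiveDefinite {Γ : Type} [Group Γ] (φ : Γ → ℂ) : Prop :=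
  ∀ (n : ℕ) (g : Fin n → Γ) (c : Fin n → ℂ),
    0 ≤ ∑ k, ∑ l, c k * (starRingEnd ℂ) (c l) * φ (g k * (g l)⁻¹)

variable (F) in
/-- The cone `Π_q = {x ^ 2 : x ∈ H_q}`, where `H_q` is the set of Hermitian `q × q` matrices. -/
def posCone (q : ℕ) : Set (Matrix (Fin q) (Fin q) F) :=
  {a | ∃ x : Matrix (Fin q) (Fin q) F, x.conjTranspose = x ∧ a = x ^ 2}

/-- The scalar product `⟨x, y⟩ = Re tr (x y)` of `H_q`. -/
def scalarProduct [ClassicalField F] {q : ℕ} (x y : Matrix (Fin q) (Fin q) F) : ℝ :=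
  ClassicalField.re (x * y).trace

/-- The function `ψ_b (a) = exp (- ⟨a², b⟩)` on `Π_q`. -/
def psi [ClassicalField F] {q : ℕ} (b : Matrix (Fin q) (Fin q) F) : posCone F q → ℂ :=
  fun a => Complex.exp (-(scalarProduct ((a : Matrix (Fin q) (Fin q) F) ^ 2) b : ℂ))

/-- The element `g_a = ((a; 0), I)` of `G_∞`. -/
def gOf {q : ℕ} (a : Matrix (Fin q) (Fin q) F) : GInf F q :=
  toGInf F q q (SemidirectProduct.inl (.ofAdd a))

/-- `φ` is a continuous `K_∞`-biinvariant function on `G_∞` which corresponds to the function `f`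
on `Π_q` under the identification of `Π_q` with the double coset space by `a ↦ K_∞ g_a K_∞`. -/
structure Represents {q : ℕ} (φ : GInf F q → ℂ) (f : posCone F q → ℂ) : Prop where
  continuous : Continuous φ
  biinvariant : IsBiinvariant φ
  apply_gOf : ∀ a : posCone F q, φ (gOf (a : Matrix (Fin q) (Fin q) F)) = f a

end OlshanskiMotion

end

/-! Biinvariance removes the unitary part of a group element, and two matrices lie in one orbit of
left unitary multiplication exactly when their Gram matrices agree (`exists_unitary_mul_eq`). So `φ
(x, k) = f (x* x)` with `f` (called `profile φ`) continuous on the cone.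

The Gram matrix of `x + k y` is `x* x + y* y` plus cross terms that involve only a fixed corner
block of `k`. Entries of a Haar-random `k` in `U_p` have mean square `1 / p`, so the cross terms die
out (`tendsto_integral_gram`). The product formula therefore says `f (r + s) = f r * f s`
(`isOlshanskiSpherical_iff`).

Positive definiteness makes `f` real and at most `1`; multiplicativity and continuity make it
strictly positive. Thus `-log f` is continuous, additive and nonnegative on the cone, so it extends
to a real linear form, and self-duality of the cone yields `b` (`exists_frob_of_additive`).
Conversely, for `b = t ^ 2` the kernel `φ (g_k g_l⁻¹)` is `exp (-‖x_k t - x_l t‖ ^ 2)`, which is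
positive definite by the Fourier transform of a Gaussian (`gaussian_kernel_nonneg`). -/

noncomputable section

set_option linter.unusedSectionVars false

open MeasureTheory Filter Topology Matrix

namespace OlshanskiMotion

variable {F : Type} [NormedDivisionRing F] [StarRing F] [NormedAlgebra ℝ F]

/-! ### Real part and norm in a classical field -/

section field

variable [ClassicalField F]

open ClassicalField

theorem re_eq_iff (t : F) (r : ℝ) : re t = r ↔ t + star t = algebraMap ℝ F (2 * r) := by
  rw [← (algebraMap ℝ F).injective.eq_iff, algebraMap_re]
  constructor
  · intro h
    rw [two_mul, map_add, ← h, ← add_smul]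
    norm_num
  · intro h
    rw [h, map_mul, Algebra.smul_def, ← mul_assoc, ← map_mul]
    norm_num

theorem add_star_self (t : F) : t + star t = algebraMap ℝ F (2 * re t) := (re_eq_iff t _).1 rfl

theorem star_algebraMap (r : ℝ) : star (algebraMap ℝ F r) = algebraMap ℝ F r := by
  rcases eq_or_ne r 0 with rfl | hr
  · simp
  have h := star_mul_self_eq (algebraMap ℝ F r)
  rw [norm_algebraMap', Real.norm_eq_abs, sq_abs, pow_two, map_mul] at h
  exact mul_right_cancel₀ (by simpa using hr) h

instance : StarModule ℝ F where
  star_smul r t := by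
    rw [Algebra.smul_def, star_mul, star_algebraMap, ← Algebra.commutes, Algebra.smul_def]
    simp

theorem re_star (t : F) : re (star t) = re t := by
  rw [re_eq_iff, star_star, add_comm, add_star_self]

theorem re_add (s t : F) : re (s + t) = re s + re t := by
  rw [re_eq_iff, star_add, add_add_add_comm, add_star_self, add_star_self, ← map_add, mul_add]

theorem re_smul (r : ℝ) (t : F) : re (r • t) = r * re t := by
  rw [re_eq_iff, star_smul, star_trivial, ← smul_add, add_star_self, Algebra.smul_def, ← map_mul]
  ring_nf

/-- The real part as a linear form. -/
def reLin : F →ₗ[ℝ] ℝ where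
  toFun := re
  map_add' := re_add
  map_smul' r t := re_smul r t

theorem re_eq_reLin (t : F) : re t = reLin t := rfl

theorem re_algebraMap (r : ℝ) : re (algebraMap ℝ F r) = r := by
  rw [re_eq_iff, star_algebraMap, ← map_add, two_mul]

theorem re_star_mul_self (t : F) : re (star t * t) = ‖t‖ ^ 2 := by
  rw [star_mul_self_eq, re_algebraMap]

theorem mul_star_self_eq (t : F) : t * star t = algebraMap ℝ F (‖t‖ ^ 2) := by
  rcases eq_or_ne t 0 with rfl | ht
  · simp
  · apply mul_right_cancel₀ ht
    rw [mul_assoc, star_mul_self_eq, Algebra.commutes]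

theorem norm_star_eq (t : F) : ‖star t‖ = ‖t‖ := by
  have h := star_mul_self_eq (star t)
  rw [star_star, mul_star_self_eq] at h
  have := (algebraMap ℝ F).injective h
  nlinarith [norm_nonneg t, norm_nonneg (star t)]

theorem re_star_mul (s t : F) : 2 * re (star s * t) = ‖s + t‖ ^ 2 - ‖s‖ ^ 2 - ‖t‖ ^ 2 := by
  have h := re_star_mul_self (s + t)
  have h1 : re (star t * s) = re (star s * t) := by rw [← re_star]; simp
  rw [star_add, add_mul, mul_add, mul_add, re_add, re_add, re_add, re_star_mul_self,
    re_star_mul_self, h1] at h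
  linarith

theorem re_mul_star (s t : F) : 2 * re (s * star t) = ‖s + t‖ ^ 2 - ‖s‖ ^ 2 - ‖t‖ ^ 2 := by
  have h := re_star_mul (star s) (star t)
  rwa [star_star, ← star_add, norm_star_eq, norm_star_eq, norm_star_eq] at h

/-- By polarization both sides depend only on the norms of `star s`, `t` and their sum. This
replaces commutativity over the quaternions and makes the real trace cyclic. -/
theorem re_mul_comm (s t : F) : re (s * t) = re (t * s) := by
  have h1 := re_star_mul (star s) t
  have h2 := re_mul_star t (star s)
  rw [star_star] at h1 h2
  rw [add_comm t] at h2
  linarith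

theorem continuous_re : Continuous (re : F → ℝ) := by
  have : FiniteDimensional ℝ F := finiteDimensional
  exact (reLin (F := F)).continuous_of_finiteDimensional

end field

/-! ### The Frobenius scalar product and Hermitian roots -/

section frobenius

variable [ClassicalField F] {m n l : Type} [Fintype m] [Fintype n] [Fintype l]

open ClassicalField

/-- The real scalar product `Re tr (x* y)` of matrices. -/
def frob (x y : Matrix m n F) : ℝ := re (xᴴ * y).trace

theorem frob_eq_sum (x y : Matrix m n F) : frob x y = ∑ j, ∑ i, re (star (x i j) * y i j) := by
  simp only [frob, trace, diag, mul_apply, conjTranspose_apply, re_eq_reLin, map_sum]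

theorem frob_self (x : Matrix m n F) : frob x x = ∑ j, ∑ i, ‖x i j‖ ^ 2 := by
  simp_rw [frob_eq_sum, re_star_mul_self]

theorem frob_self_nonneg (x : Matrix m n F) : 0 ≤ frob x x := by
  rw [frob_self]; positivity

theorem norm_sq_entry_le (x : Matrix m n F) (i : m) (j : n) : ‖x i j‖ ^ 2 ≤ frob x x := by
  rw [frob_self]
  exact (Finset.single_le_sum (f := fun i => ‖x i j‖ ^ 2) (fun _ _ => sq_nonneg _)
      (Finset.mem_univ i)).trans
    (Finset.single_le_sum (f := fun j => ∑ i, ‖x i j‖ ^ 2)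
      (fun _ _ => Finset.sum_nonneg fun _ _ => sq_nonneg _) (Finset.mem_univ j))

theorem eq_zero_of_frob_self (x : Matrix m n F) (h : frob x x = 0) : x = 0 := by
  ext i j
  have := norm_sq_entry_le x i j
  rw [h] at this
  simpa using pow_eq_zero_iff (two_ne_zero) |>.1 (le_antisymm this (sq_nonneg _))

theorem re_trace_mul_comm (x : Matrix m n F) (y : Matrix n m F) :
    re (x * y).trace = re (y * x).trace := by
  simp only [trace, diag, mul_apply, re_eq_reLin, map_sum]
  rw [Finset.sum_comm]
  simp only [← re_eq_reLin, re_mul_comm]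

theorem re_trace_conjTranspose (x : Matrix m m F) : re xᴴ.trace = re x.trace := by
  rw [trace_conjTranspose, re_star]

theorem frob_comm (x y : Matrix m n F) : frob x y = frob y x := by
  rw [frob, ← re_trace_conjTranspose, conjTranspose_mul, conjTranspose_conjTranspose, frob]

theorem frob_conjTranspose (x y : Matrix m n F) : frob xᴴ yᴴ = frob x y := by
  rw [frob_comm, frob, conjTranspose_conjTranspose, re_trace_mul_comm, frob]

theorem frob_add_left (x y z : Matrix m n F) : frob (x + y) z = frob x z + frob y z := by
  rw [frob, conjTranspose_add, Matrix.add_mul, trace_add, re_add]; rfl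

theorem frob_add_right (x y z : Matrix m n F) : frob x (y + z) = frob x y + frob x z := by
  rw [frob, Matrix.mul_add, trace_add, re_add]; rfl

theorem frob_smul_right (r : ℝ) (x y : Matrix m n F) : frob x (r • y) = r * frob x y := by
  rw [frob, Matrix.mul_smul, trace_smul, re_smul]; rfl

theorem frob_smul_left (r : ℝ) (x y : Matrix m n F) : frob (r • x) y = r * frob x y := by
  rw [frob_comm, frob_smul_right, frob_comm]

theorem frob_mul_left (a : Matrix m l F) (x : Matrix l n F) (y : Matrix m n F) :
    frob (a * x) y = frob x (aᴴ * y) := by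
  rw [frob, frob, conjTranspose_mul, Matrix.mul_assoc]

variable (F m n) in
/-- Real `m × n`-matrices over `F` as a real inner product space. -/
@[reducible] def frobCore : InnerProductSpace.Core ℝ (Matrix m n F) where
  inner := frob
  conj_inner_symm x y := by simp [frob_comm y x]
  re_inner_nonneg x := by simpa using frob_self_nonneg x
  add_left := frob_add_left
  smul_left x y r := by simp [frob_smul_left]
  definite := eq_zero_of_frob_self

theorem finiteDimensional_matrix : FiniteDimensional ℝ (Matrix m n F) := by
  have : FiniteDimensional ℝ F := finiteDimensional
  exact Module.Finite.matrix

theorem exists_inner_representation {E : Type} [NormedAddCommGroup E] [InnerProductSpace ℝ E]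
    [FiniteDimensional ℝ E] (L : E →ₗ[ℝ] ℝ) : ∃ b, ∀ x, L x = inner ℝ b x :=
  ⟨(InnerProductSpace.toDual ℝ E).symm (LinearMap.toContinuousLinearMap L),
    fun _ => by rw [InnerProductSpace.toDual_symm_apply, LinearMap.coe_toContinuousLinearMap']⟩

theorem exists_frob_representation (L : Matrix m n F →ₗ[ℝ] ℝ) : ∃ b, ∀ x, L x = frob b x := by
  let := (frobCore F m n).toNormedAddCommGroup
  let := InnerProductSpace.ofCore (frobCore F m n).toCore
  have : FiniteDimensional ℝ (Matrix m n F) := finiteDimensional_matrix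
  exact exists_inner_representation L

variable [DecidableEq n]

theorem IsHermitian_aeval {a : Matrix n n F} (ha : aᴴ = a) (p : Polynomial ℝ) :
    (Polynomial.aeval a p)ᴴ = Polynomial.aeval a p := by
  induction p using Polynomial.induction_on' with
  | add p r hp hr => simp [hp, hr]
  | monomial k r =>
    rw [Polynomial.aeval_monomial, ← Algebra.smul_def, conjTranspose_smul, conjTranspose_pow, ha,
      star_trivial]

/-- A Hermitian matrix with nonnegative quadratic form has a Hermitian fourth root. -/
theorem exists_fourth_root {a : Matrix n n F} (ha : aᴴ = a) (hp : ∀ x, 0 ≤ frob x (a * x)) :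
    ∃ t : Matrix n n F, tᴴ = t ∧ (t ^ 2) ^ 2 = a := by
  let := (frobCore F n n).toNormedAddCommGroup
  let := InnerProductSpace.ofCore (frobCore F n n).toCore
  have : FiniteDimensional ℝ (Matrix n n F) := finiteDimensional_matrix
  -- Left multiplication by `a` is a symmetric operator on a real Euclidean space, so the real
  -- spectral theorem applies even over the quaternions.
  set T : Module.End ℝ (Matrix n n F) := Algebra.lmul ℝ (Matrix n n F) a with hT
  have hsym : T.IsSymmetric := fun x y => by
    change frob (a * x) y = frob x (a * y)
    rw [frob_mul_left, ha]
  set ev := hsym.eigenvalues rfl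
  have hev : ∀ i, 0 ≤ ev i := by
    intro i
    have h := hp (hsym.eigenvectorBasis rfl i)
    have h2 : a * hsym.eigenvectorBasis rfl i = ev i • hsym.eigenvectorBasis rfl i :=
      hsym.apply_eigenvectorBasis rfl i
    rw [h2, frob_smul_right] at h
    have h3 : frob (hsym.eigenvectorBasis rfl i) (hsym.eigenvectorBasis rfl i) = 1 := by
      have := (hsym.eigenvectorBasis rfl).orthonormal.1 i
      have h4 := real_inner_self_eq_norm_sq (hsym.eigenvectorBasis rfl i)
      rw [this] at h4
      exact h4.trans (one_pow 2)
    rwa [h3, mul_one] at h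
  -- The root is a real polynomial in `a`, hence Hermitian; only its values on the finite spectrum
  -- matter.
  let p : Polynomial ℝ := Lagrange.interpolate (Finset.univ.image ev) id fun r => √√r
  have hpe : ∀ i, p.eval (ev i) = √√(ev i) := fun i =>
    Lagrange.eval_interpolate_at_node (v := id) _ Function.injective_id.injOn
      (Finset.mem_image_of_mem _ (Finset.mem_univ i))
  refine ⟨Polynomial.aeval a p, IsHermitian_aeval ha p, ?_⟩
  apply Algebra.lmul_injective (R := ℝ)
  rw [← pow_mul, map_pow, ← Polynomial.aeval_algHom_apply, ← map_pow]
  refine (hsym.eigenvectorBasis rfl).toBasis.ext fun i => ?_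
  rw [OrthonormalBasis.coe_toBasis]
  have he := hsym.hasEigenvector_eigenvectorBasis rfl i
  have h1 := Module.End.aeval_apply_of_hasEigenvector (p := p ^ (2 * 2)) he
  refine h1.trans ?_
  refine Eq.trans ?_ he.apply_eq_smul.symm
  congr 1
  rw [Polynomial.eval_pow]
  change (p.eval (ev i)) ^ _ = ev i
  rw [hpe, pow_mul, Real.sq_sqrt (Real.sqrt_nonneg _), Real.sq_sqrt (hev i)]

end frobenius

end OlshanskiMotion

namespace OlshanskiMotion

/-! ### Positive definiteness of the Gaussian kernel -/

section gaussian

/-- The Gaussian kernel on a Euclidean space is positive definite. -/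
theorem gaussian_kernel_nonneg {E : Type} [NormedAddCommGroup E] [InnerProductSpace ℝ E]
    [FiniteDimensional ℝ E] {n : ℕ} (v : Fin n → E) (c : Fin n → ℂ) :
    ∃ r : ℝ, 0 ≤ r ∧ ∑ k, ∑ l, c k * (starRingEnd ℂ) (c l) *
      Complex.exp (-((‖v k - v l‖ ^ 2 : ℝ) : ℂ)) = r := by
  let : MeasurableSpace E := borel E
  have : BorelSpace E := ⟨rfl⟩
  -- With width parameter `1 / 4` the Fourier transform is a constant `K` times exactly `exp (-‖w‖ ^
  -- 2)`.
  have hb : 0 < ((1 / 4 : ℝ) : ℂ).re := by rw [Complex.ofReal_re]; norm_num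
  have key := fun w : E => GaussianFourier.integral_cexp_neg_mul_sq_norm_add hb Complex.I w
  have hint := fun w : E => GaussianFourier.integrable_cexp_neg_mul_sq_norm_add hb Complex.I w
  set K : ℝ := (Real.pi / (1 / 4)) ^ (Module.finrank ℝ E / 2 : ℝ) with hK
  have hKpos : 0 < K := by positivity
  have hKc : ((Real.pi : ℂ) / ((1 / 4 : ℝ) : ℂ)) ^ (Module.finrank ℝ E / 2 : ℂ) = (K : ℂ) := by
    rw [hK, Complex.ofReal_cpow (by positivity)]
    push_cast
    rfl
  have key' : ∀ w : E, Complex.exp (-((‖w‖ ^ 2 : ℝ) : ℂ)) = (K : ℂ)⁻¹ *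
      ∫ x : E, Complex.exp (-((1 / 4 : ℝ) : ℂ) * ‖x‖ ^ 2 + Complex.I * inner ℝ w x) := by
    intro w
    rw [key w, hKc, ← mul_assoc, inv_mul_cancel₀ (by exact_mod_cast hKpos.ne'), one_mul,
      Complex.I_sq]
    congr 1
    push_cast
    ring
  -- Under the integral, the double sum becomes the squared modulus of a single exponential sum.
  refine ⟨K⁻¹ * ∫ x : E, Real.exp (-(1 / 4) * ‖x‖ ^ 2) *
    ‖∑ k, c k * Complex.exp (Complex.I * inner ℝ (v k) x)‖ ^ 2, ?_, ?_⟩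
  · exact mul_nonneg (by positivity) (integral_nonneg fun x => by positivity)
  · simp_rw [key', mul_left_comm _ ((K : ℂ)⁻¹), ← Finset.mul_sum]
    simp_rw [← integral_const_mul (c _ * (starRingEnd ℂ) (c _))]
    rw [Complex.ofReal_mul, Complex.ofReal_inv, ← integral_complex_ofReal]
    congr 1
    simp_rw [← integral_finsetSum _ fun l _ => (hint _).const_mul _]
    rw [← integral_finsetSum _ fun k _ => integrable_finsetSum _ fun l _ =>
      (hint _).const_mul _]
    congr 1
    ext x
    have hs : ((‖∑ k, c k * Complex.exp (Complex.I * inner ℝ (v k) x)‖ ^ 2 : ℝ) : ℂ) =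
        ∑ k, ∑ l, (c k * Complex.exp (Complex.I * inner ℝ (v k) x)) *
          (starRingEnd ℂ) (c l * Complex.exp (Complex.I * inner ℝ (v l) x)) := by
      rw [← Finset.sum_mul_sum, ← map_sum, Complex.mul_conj']
      push_cast
      rfl
    rw [Complex.ofReal_mul, hs, Finset.mul_sum]
    refine Finset.sum_congr rfl fun k _ => ?_
    rw [Finset.mul_sum]
    refine Finset.sum_congr rfl fun l _ => ?_
    rw [map_mul, ← Complex.exp_conj, map_mul, Complex.conj_I, Complex.conj_ofReal, inner_sub_left,
      Complex.exp_add, Complex.ofReal_exp, Complex.ofReal_sub, mul_sub, sub_eq_add_neg,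
      Complex.exp_add, neg_mul]
    push_cast
    ring_nf

end gaussian

variable {F : Type} [NormedDivisionRing F] [StarRing F] [NormedAlgebra ℝ F]

/-! ### The cone of positive semidefinite matrices -/

section cone

variable [ClassicalField F] {m : Type} [Fintype m] {q : ℕ}

theorem frob_gaussian_kernel_nonneg {p n : ℕ} (v : Fin n → Matrix (Fin p) (Fin q) F)
    (c : Fin n → ℂ) :
    ∃ r : ℝ, 0 ≤ r ∧ ∑ k, ∑ l, c k * (starRingEnd ℂ) (c l) *
      Complex.exp (-((frob (v k - v l) (v k - v l) : ℝ) : ℂ)) = r := by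
  let := (frobCore F (Fin p) (Fin q)).toNormedAddCommGroup
  let := InnerProductSpace.ofCore (frobCore F (Fin p) (Fin q)).toCore
  have : FiniteDimensional ℝ (Matrix (Fin p) (Fin q) F) := finiteDimensional_matrix
  obtain ⟨r, hr, h⟩ := gaussian_kernel_nonneg v c
  refine ⟨r, hr, ?_⟩
  simp_rw [← real_inner_self_eq_norm_sq] at h
  exact h

/-- The quadratic-form description makes closedness and stability under sums evident, which the
definition by squares does not. -/
theorem mem_posCone_iff {a : Matrix (Fin q) (Fin q) F} :
    a ∈ posCone F q ↔ aᴴ = a ∧ ∀ x, 0 ≤ frob x (a * x) := by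
  constructor
  · rintro ⟨t, ht, rfl⟩
    refine ⟨by rw [conjTranspose_pow, ht], fun x => ?_⟩
    have : frob x (t ^ 2 * x) = frob (t * x) (t * x) := by
      rw [frob_mul_left, ht, pow_two, Matrix.mul_assoc]
    rw [this]
    exact frob_self_nonneg _
  · rintro ⟨ha, hp⟩
    obtain ⟨t, ht, rfl⟩ := exists_fourth_root ha hp
    exact ⟨t ^ 2, by rw [conjTranspose_pow, ht], rfl⟩

/-- A fourth root `t` is what is needed: the square root `t ^ 2` is then itself a Hermitian square.
-/
theorem exists_sqrt_mem_posCone {a : Matrix (Fin q) (Fin q) F} (ha : a ∈ posCone F q) :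
    ∃ s ∈ posCone F q, s ^ 2 = a := by
  obtain ⟨ha, hp⟩ := mem_posCone_iff.1 ha
  obtain ⟨t, ht, rfl⟩ := exists_fourth_root ha hp
  exact ⟨t ^ 2, ⟨t, ht, rfl⟩, rfl⟩

theorem conjTranspose_of_mem_posCone {a : Matrix (Fin q) (Fin q) F} (ha : a ∈ posCone F q) :
    aᴴ = a := (mem_posCone_iff.1 ha).1

theorem conjTranspose_mul_self_mem_posCone (x : Matrix m (Fin q) F) : xᴴ * x ∈ posCone F q := by
  refine mem_posCone_iff.2 ⟨by simp, fun y => ?_⟩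
  rw [Matrix.mul_assoc, ← frob_mul_left]
  exact frob_self_nonneg _

theorem add_mem_posCone {a b : Matrix (Fin q) (Fin q) F} (ha : a ∈ posCone F q)
    (hb : b ∈ posCone F q) : a + b ∈ posCone F q := by
  rw [mem_posCone_iff] at *
  refine ⟨by rw [conjTranspose_add, ha.1, hb.1], fun x => ?_⟩
  rw [Matrix.add_mul, frob_add_right]
  exact add_nonneg (ha.2 x) (hb.2 x)

end cone

/-! ### Unitary orbits and Gram matrices -/

section householder

variable [ClassicalField F] [CStarRing F]

/-- Unitary reflections act transitively on vectors of equal length. -/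
theorem exists_unitary_reflection {p : ℕ} (v w : Matrix (Fin p) (Fin 1) F)
    (h : vᴴ * v = wᴴ * w) :
    ∃ u : U F p, u.1 * v = w ∧
      ∀ x : Matrix (Fin p) (Fin 1) F, vᴴ * x = wᴴ * x → u.1 * x = x := by
  by_cases hz : v = w
  · exact ⟨1, by simp [hz], fun x _ => by simp⟩
  set z := v - w with hzdef
  -- The reflection is `1 - z d⁻¹ z*`. As `d` need be neither real nor central, it replaces the
  -- usual `‖z‖ ^ 2 / 2`, and scalars are kept as `1 × 1` matrices to preserve the order of factors.
  set d : Matrix (Fin 1) (Fin 1) F := zᴴ * v with hd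
  -- Equality of lengths enters here; this identity is what makes the reflection unitary.
  have hdd : zᴴ * z = d + dᴴ := by
    simp only [hd, hzdef, conjTranspose_mul, conjTranspose_sub, conjTranspose_conjTranspose,
      Matrix.sub_mul, Matrix.mul_sub, h]
    abel
  have hd0 : d 0 0 ≠ 0 := by
    intro h0
    have hd0 : d = 0 := by
      ext i j
      rw [Subsingleton.elim i 0, Subsingleton.elim j 0, h0, Matrix.zero_apply]
    refine hz (sub_eq_zero.1 (eq_zero_of_frob_self z ?_))
    rw [frob, hdd, hd0, conjTranspose_zero, add_zero, trace_zero, re_eq_reLin, map_zero]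
  set c : Matrix (Fin 1) (Fin 1) F := of fun _ _ => (d 0 0)⁻¹ with hc
  have hcd : c * d = 1 := by
    ext i j
    rw [Subsingleton.elim i 0, Subsingleton.elim j 0]
    simp [mul_apply, hc, hd0]
  have hdc : d * c = 1 := by
    ext i j
    rw [Subsingleton.elim i 0, Subsingleton.elim j 0]
    simp [mul_apply, hc, hd0]
  have hcd' : dᴴ * cᴴ = 1 := by rw [← conjTranspose_mul, hcd, conjTranspose_one]
  have hdc' : cᴴ * dᴴ = 1 := by rw [← conjTranspose_mul, hdc, conjTranspose_one]
  have e1 : cᴴ * (zᴴ * z) * c = cᴴ + c := by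
    rw [hdd, Matrix.mul_add, Matrix.add_mul, Matrix.mul_assoc, hdc, hdc', Matrix.mul_one,
      Matrix.one_mul]
  have e2 : c * (zᴴ * z) * cᴴ = cᴴ + c := by
    rw [hdd, Matrix.mul_add, Matrix.add_mul, Matrix.mul_assoc c dᴴ, hcd, hcd', Matrix.mul_one,
      Matrix.one_mul]
  have hst : star (1 - z * c * zᴴ) = 1 - z * cᴴ * zᴴ := by
    rw [star_eq_conjTranspose, conjTranspose_sub, conjTranspose_one, conjTranspose_mul,
      conjTranspose_mul, conjTranspose_conjTranspose, Matrix.mul_assoc]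
  have expand : ∀ a b : Matrix (Fin 1) (Fin 1) F, a * (zᴴ * z) * b = b + a →
      (1 - z * a * zᴴ) * (1 - z * b * zᴴ) = 1 := by
    intro a b hab
    have : z * a * zᴴ * (z * b * zᴴ) = z * (a * (zᴴ * z) * b) * zᴴ := by
      simp only [Matrix.mul_assoc]
    rw [Matrix.sub_mul, Matrix.mul_sub, Matrix.one_mul, Matrix.one_mul, Matrix.mul_sub,
      Matrix.mul_one, this, hab, Matrix.mul_add, Matrix.add_mul]
    abel
  refine ⟨⟨1 - z * c * zᴴ, ?_⟩, ?_, ?_⟩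
  · rw [Unitary.mem_iff, hst]
    exact ⟨expand _ _ (e1.trans (add_comm _ _)), expand _ _ e2⟩
  · change (1 - z * c * zᴴ) * v = w
    rw [Matrix.sub_mul, Matrix.mul_assoc, ← hd, Matrix.mul_assoc, hcd, Matrix.one_mul,
      Matrix.mul_one, hzdef]
    abel
  · intro x hx
    change (1 - z * c * zᴴ) * x = x
    have : zᴴ * x = 0 := by
      rw [hzdef, conjTranspose_sub, Matrix.sub_mul, hx, sub_self]
    rw [Matrix.sub_mul, Matrix.mul_assoc, this, Matrix.mul_zero, Matrix.one_mul, sub_zero]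

theorem conjTranspose_mul_self_unitary_mul {p q : ℕ} (u : U F p)
    (x y : Matrix (Fin p) (Fin q) F) : (u.1 * x)ᴴ * (u.1 * y) = xᴴ * y := by
  rw [conjTranspose_mul, Matrix.mul_assoc, ← Matrix.mul_assoc u.1ᴴ, ← star_eq_conjTranspose,
    (Unitary.mem_iff.1 u.2).1, Matrix.one_mul]

/-- The unitary group acts transitively on matrices with a given Gram matrix. -/
theorem exists_unitary_mul_eq {p q : ℕ} {x y : Matrix (Fin p) (Fin q) F}
    (h : xᴴ * x = yᴴ * y) : ∃ u : U F p, u.1 * y = x := by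
  -- Columns are matched one at a time. Since the Gram matrices agree, columns already matched have
  -- equal products with the old and the new vector, so the next reflection fixes them.
  suffices H : ∀ j ≤ q, ∃ u : U F p, ∀ i : Fin q, i.val < j → ∀ r, (u.1 * y) r i = x r i by
    obtain ⟨u, hu⟩ := H q le_rfl
    exact ⟨u, by ext r i; exact hu i i.2 r⟩
  intro j
  induction j with
  | zero => exact fun _ => ⟨1, fun i hi => absurd hi (Nat.not_lt_zero _)⟩
  | succ j ih =>
    intro hj
    obtain ⟨u, hu⟩ := ih (Nat.le_of_succ_le hj)
    let col : Matrix (Fin p) (Fin q) F → Fin q → Matrix (Fin p) (Fin 1) F :=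
      fun a i => a.submatrix id fun _ => i
    have hcol : ∀ a i i', (col a i)ᴴ * col a i' = of fun _ _ => (aᴴ * a) i i' := by
      intro a i i'
      ext
      simp [col, mul_apply]
    have hg : (u.1 * y)ᴴ * (u.1 * y) = xᴴ * x := by
      rw [conjTranspose_mul_self_unitary_mul, h]
    have hprev : ∀ i : Fin q, i.val < j → col (u.1 * y) i = col x i := by
      intro i hi
      ext r s
      exact hu i hi r
    obtain ⟨w, hw1, hw2⟩ := exists_unitary_reflection (col (u.1 * y) ⟨j, hj⟩) (col x ⟨j, hj⟩)
      (by rw [hcol, hcol, hg])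
    refine ⟨w * u, fun i hi r => ?_⟩
    have hmul : ∀ i, col ((w * u).1 * y) i = w.1 * col (u.1 * y) i := by
      intro i
      ext r s
      simp only [col, Submonoid.coe_mul, Matrix.mul_assoc]
      rfl
    suffices hc : col ((w * u).1 * y) i = col x i from congrFun (congrFun hc r) 0
    rw [hmul]
    rcases Nat.lt_succ_iff_lt_or_eq.1 hi with hi | hi
    · rw [hprev i hi]
      apply hw2
      conv_lhs => rw [← hprev i hi]
      rw [hcol, hcol, hg]
    · obtain rfl : i = ⟨j, hj⟩ := Fin.ext hi
      exact hw1

end householder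

end OlshanskiMotion

namespace OlshanskiMotion

variable {F : Type} [NormedDivisionRing F] [StarRing F] [NormedAlgebra ℝ F]

/-! ### Products with zero-padded matrices -/

section padding

variable {q m p : ℕ}

theorem conjTranspose_padRows_mul {l : Type} (h : m ≤ p) (x : Matrix (Fin m) (Fin q) F)
    (a : Matrix (Fin p) l F) : (padRows p x)ᴴ * a = xᴴ * a.submatrix (Fin.castLE h) id := by
  obtain ⟨d, rfl⟩ := Nat.exists_eq_add_of_le h
  ext i j
  rw [mul_apply, mul_apply, Fin.sum_univ_add]
  simp [padRows]
  rfl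

theorem mul_padRows {l : Type} (h : m ≤ p) (x : Matrix (Fin m) (Fin q) F)
    (a : Matrix l (Fin p) F) : a * padRows p x = a.submatrix id (Fin.castLE h) * x := by
  obtain ⟨d, rfl⟩ := Nat.exists_eq_add_of_le h
  ext i j
  rw [mul_apply, mul_apply, Fin.sum_univ_add]
  simp [padRows]
  rfl

theorem padRows_submatrix (h : m ≤ p) (x : Matrix (Fin m) (Fin q) F) :
    (padRows p x).submatrix (Fin.castLE h) id = x := by
  ext i j
  simp [padRows]

theorem conjTranspose_padRows_mul_padRows (h : m ≤ p) (x y : Matrix (Fin m) (Fin q) F) :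
    (padRows p x)ᴴ * padRows p y = xᴴ * y := by
  rw [conjTranspose_padRows_mul h, padRows_submatrix]

end padding

variable [ClassicalField F] [CStarRing F]

/-! ### A compactness bound -/

section bound

/-- A continuous function on a compact set which vanishes with `N` is bounded by `ε + C N`. -/
theorem exists_norm_le_add_mul {X : Type} [TopologicalSpace X] {S : Set X} (hS : IsCompact S)
    {h : X → ℂ} (hh : ContinuousOn h S) {N : X → ℝ} (hN : ContinuousOn N S)
    (hN0 : ∀ z ∈ S, 0 ≤ N z) (h0 : ∀ z ∈ S, N z = 0 → h z = 0) {ε : ℝ} (hε : 0 < ε) :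
    ∃ C : ℝ, 0 ≤ C ∧ ∀ z ∈ S, ‖h z‖ ≤ ε + C * N z := by
  obtain ⟨M, hM⟩ := hS.exists_bound_of_continuousOn hh
  -- On this compact set `N` does not vanish, so it has a positive minimum.
  have hK : IsCompact (S ∩ {z | ε ≤ ‖h z‖}) := by
    obtain ⟨u, hu, hu'⟩ := continuousOn_iff_isClosed.1 hh.norm (Set.Ici ε) isClosed_Ici
    have : S ∩ {z | ε ≤ ‖h z‖} = S ∩ u := by
      rw [Set.inter_comm S u, ← hu', Set.inter_comm]
      rfl
    rw [this]
    exact hS.inter_right hu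
  rcases (S ∩ {z | ε ≤ ‖h z‖}).eq_empty_or_nonempty with he | hne
  · refine ⟨0, le_rfl, fun z hz => ?_⟩
    by_contra hlt
    have : z ∈ S ∩ {z | ε ≤ ‖h z‖} := ⟨hz, by simp at hlt ⊢; exact hlt.le⟩
    rw [he] at this
    exact this
  · obtain ⟨z₀, hz₀, hmin⟩ := hK.exists_isMinOn hne (hN.mono Set.inter_subset_left)
    have hpos : 0 < N z₀ := by
      refine lt_of_le_of_ne (hN0 _ hz₀.1) fun h1 => ?_
      have h2 := hz₀.2
      rw [Set.mem_ofPred_eq, h0 _ hz₀.1 h1.symm, norm_zero] at h2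
      exact absurd h2 (not_le.2 hε)
    have hM0 : 0 ≤ M := (norm_nonneg _).trans (hM _ hz₀.1)
    refine ⟨M / N z₀, by positivity, fun z hz => ?_⟩
    have hz0 := hN0 z hz
    by_cases hzε : ε ≤ ‖h z‖
    · have h1 : N z₀ ≤ N z := hmin ⟨hz, hzε⟩
      have h2 : M ≤ M / N z₀ * N z := by
        rw [div_mul_eq_mul_div, le_div_iff₀ hpos]
        gcongr
      linarith [hM z hz]
    · have : 0 ≤ M / N z₀ * N z := by positivity
      linarith

end bound

/-! ### Second moments of Haar unitary matrices -/

section haar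

variable {p : ℕ}

instance : (haarU F p).IsHaarMeasure := Measure.isHaarMeasure_haarMeasure _

instance : IsProbabilityMeasure (haarU F p) :=
  ⟨by simpa [haarU] using Measure.haarMeasure_self (K₀ := (⊤ : TopologicalSpace.PositiveCompacts (U F p)))⟩

theorem integrable_haarU {E : Type} [NormedAddCommGroup E] {f : U F p → E} (hf : Continuous f) :
    Integrable f (haarU F p) :=
  hf.integrable_of_hasCompactSupport (HasCompactSupport.of_compactSpace f)

theorem continuous_coe_entry (a b : Fin p) : Continuous fun k : U F p => k.1 a b :=
  continuous_subtype_val.matrix_elem a b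

theorem sum_norm_sq_column (k : U F p) (b : Fin p) : ∑ a, ‖k.1 a b‖ ^ 2 = 1 := by
  have h := congrFun (congrFun (Unitary.coe_star_mul_self k) b) b
  rw [Matrix.mul_apply] at h
  simp only [Matrix.star_apply, ClassicalField.star_mul_self_eq, Matrix.one_apply_eq] at h
  rw [← map_sum, ← map_one (algebraMap ℝ F)] at h
  exact (algebraMap ℝ F).injective h

/-- Permutation matrices, as unitary matrices. -/
def permU (σ : Equiv.Perm (Fin p)) : U F p :=
  ⟨σ.permMatrix F, by
    rw [Unitary.mem_iff, star_eq_conjTranspose, conjTranspose_permMatrix, ← permMatrix_mul,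
      ← permMatrix_mul]
    simp⟩

theorem permU_mul_apply (σ : Equiv.Perm (Fin p)) (k : U F p) (a b : Fin p) :
    (permU σ * k).1 a b = k.1 (σ a) b := by
  change (σ.permMatrix F * k.1) a b = _
  rw [Equiv.Perm.permMatrix, PEquiv.toMatrix_toPEquiv_mul]
  rfl

/-- Mean square of the entries of a random unitary matrix. -/
theorem integral_norm_sq_entry (a b : Fin p) :
    ∫ k : U F p, ‖k.1 a b‖ ^ 2 ∂haarU F p = (p : ℝ)⁻¹ := by
  have hint : ∀ a', Integrable (fun k : U F p => ‖k.1 a' b‖ ^ 2) (haarU F p) :=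
    fun a' => integrable_haarU ((continuous_coe_entry a' b).norm.pow 2)
  -- Left translation by a transposition swaps rows, so all entries of a column share one mean; the
  -- squared norms in a column sum to `1`.
  have hinv : ∀ a', ∫ k : U F p, ‖k.1 a' b‖ ^ 2 ∂haarU F p =
      ∫ k : U F p, ‖k.1 a b‖ ^ 2 ∂haarU F p := by
    intro a'
    rw [← integral_mul_left_eq_self (fun k : U F p => ‖k.1 a b‖ ^ 2) (permU (Equiv.swap a a'))]
    simp_rw [permU_mul_apply, Equiv.swap_apply_left]
  have hsum : ∑ a', ∫ k : U F p, ‖k.1 a' b‖ ^ 2 ∂haarU F p = 1 := by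
    rw [← integral_finsetSum _ fun a' _ => hint a']
    simp_rw [sum_norm_sq_column]
    simp
  simp_rw [hinv] at hsum
  rw [Finset.sum_const, Finset.card_univ, Fintype.card_fin, nsmul_eq_mul] at hsum
  exact eq_inv_of_mul_eq_one_right hsum

end haar

/-! ### Vanishing of the cross terms -/

section concentration

variable {q : ℕ}

theorem continuous_frob_self {m n : Type} [Fintype m] [Fintype n] :
    Continuous fun x : Matrix m n F => frob x x := by
  simp_rw [frob_self]
  fun_prop

theorem isClosed_posCone : IsClosed (posCone F q) := by
  have : posCone F q = {a | aᴴ = a} ∩ ⋂ x, {a | 0 ≤ frob x (a * x)} := by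
    ext a
    simp [mem_posCone_iff]
  rw [this]
  refine (isClosed_eq (by fun_prop) continuous_id).inter (isClosed_iInter fun x => ?_)
  refine isClosed_le continuous_const ?_
  exact continuous_re.comp (Continuous.matrix_trace (by fun_prop))

theorem isCompact_entry_le {m n : Type} [Fintype m] [Fintype n] (R : ℝ) :
    IsCompact {x : Matrix m n F | ∀ i j, ‖x i j‖ ≤ R} := by
  have : FiniteDimensional ℝ F := ClassicalField.finiteDimensional
  have : ProperSpace F := FiniteDimensional.proper ℝ F
  have hc : IsCompact (Set.pi Set.univ fun _ : m => Set.pi Set.univ fun _ : n =>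
      Metric.closedBall (0 : F) R) :=
    isCompact_univ_pi fun _ => isCompact_univ_pi fun _ => isCompact_closedBall _ _
  refine (congrArg IsCompact (Set.ext fun x => ?_)).mpr hc
  exact ⟨fun h i _ j _ => mem_closedBall_zero_iff.2 (h i j),
    fun h i j => mem_closedBall_zero_iff.1 (h i trivial j trivial)⟩

theorem gram_padRows_add_mul {m p : ℕ} (h : m ≤ p) (x y : Matrix (Fin m) (Fin q) F)
    (k : U F p) :
    (padRows p x + k.1 * padRows p y)ᴴ * (padRows p x + k.1 * padRows p y) =
      xᴴ * x + yᴴ * y + (xᴴ * k.1.submatrix (Fin.castLE h) (Fin.castLE h) * y +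
        (xᴴ * k.1.submatrix (Fin.castLE h) (Fin.castLE h) * y)ᴴ) := by
  have h1 : (padRows p x)ᴴ * (k.1 * padRows p y) =
      xᴴ * k.1.submatrix (Fin.castLE h) (Fin.castLE h) * y := by
    rw [conjTranspose_padRows_mul h, mul_padRows h, Matrix.mul_assoc]
    rfl
  have h2 : (k.1 * padRows p y)ᴴ * padRows p x =
      (xᴴ * k.1.submatrix (Fin.castLE h) (Fin.castLE h) * y)ᴴ := by
    rw [← h1, conjTranspose_mul (padRows p x)ᴴ, conjTranspose_conjTranspose]
  rw [conjTranspose_add, Matrix.add_mul, Matrix.mul_add, Matrix.mul_add, h1, h2,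
    conjTranspose_mul_self_unitary_mul, conjTranspose_padRows_mul_padRows h,
    conjTranspose_padRows_mul_padRows h]
  abel

/-- Concentration: the cross terms in the Gram matrix of `x + k y` vanish for `p → ∞`. -/
theorem tendsto_integral_gram {f : Matrix (Fin q) (Fin q) F → ℂ}
    (hf : ContinuousOn f (posCone F q)) {m : ℕ} (x y : Matrix (Fin m) (Fin q) F) :
    Tendsto (fun p : ℕ => ∫ k : U F p, f ((padRows p x + k.1 * padRows p y)ᴴ *
      (padRows p x + k.1 * padRows p y)) ∂haarU F p) atTop (𝓝 (f (xᴴ * x + yᴴ * y))) := by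
  -- Here `z` stands for the upper left `m × m` block of `k`, so the domain does not depend on `p`.
  let arg : Matrix (Fin m) (Fin m) F → Matrix (Fin q) (Fin q) F :=
    fun z => xᴴ * x + yᴴ * y + (xᴴ * z * y + (xᴴ * z * y)ᴴ)
  have harg : Continuous arg := by fun_prop
  have harg0 : arg 0 = xᴴ * x + yᴴ * y := by simp [arg]
  -- `f` is continuous only on the cone, so blocks are restricted to those whose argument lies
  -- there.
  let S : Set (Matrix (Fin m) (Fin m) F) := {z | ∀ i j, ‖z i j‖ ≤ 1} ∩ arg ⁻¹' posCone F q
  have hS : IsCompact S := (isCompact_entry_le 1).inter_right (isClosed_posCone.preimage harg)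
  have hfarg : ContinuousOn (fun z => f (arg z)) S :=
    hf.comp harg.continuousOn fun z hz => hz.2
  rw [Metric.tendsto_atTop]
  intro ε hε
  obtain ⟨C, hC, hbound⟩ := exists_norm_le_add_mul hS
    (h := fun z => f (arg z) - f (xᴴ * x + yᴴ * y)) (hfarg.sub continuousOn_const)
    (N := fun z => frob z z) continuous_frob_self.continuousOn (fun z _ => frob_self_nonneg z)
    (fun z _ hz => by rw [eq_zero_of_frob_self z hz, harg0, sub_self]) (half_pos hε)
  have hlim : Tendsto (fun p : ℕ => ε / 2 + C * (m * (m * (p : ℝ)⁻¹))) atTop (𝓝 (ε / 2)) := by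
    have := tendsto_inv_atTop_nhds_zero_nat (𝕜 := ℝ)
    simpa using (((this.const_mul (m : ℝ)).const_mul (m : ℝ)).const_mul C).const_add (ε / 2)
  obtain ⟨P, hP⟩ := eventually_atTop.1 (hlim.eventually (gt_mem_nhds (half_lt_self hε)))
  refine ⟨max P m, fun p hp => ?_⟩
  have hmp : m ≤ p := (le_max_right _ _).trans hp
  let blk : U F p → Matrix (Fin m) (Fin m) F :=
    fun k => k.1.submatrix (Fin.castLE hmp) (Fin.castLE hmp)
  have hgram : ∀ k : U F p, (padRows p x + k.1 * padRows p y)ᴴ *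
      (padRows p x + k.1 * padRows p y) = arg (blk k) := gram_padRows_add_mul hmp x y
  have hblk : Continuous blk := continuous_subtype_val.matrix_submatrix _ _
  have hblkS : ∀ k, blk k ∈ S := fun k =>
    ⟨fun i j => norm_entry_le k _ _, by
      rw [Set.mem_preimage, ← hgram]
      exact conjTranspose_mul_self_mem_posCone _⟩
  have hcont : Continuous fun k => f (arg (blk k)) := hfarg.comp_continuous hblk hblkS
  have hfrob : ∫ k : U F p, frob (blk k) (blk k) ∂haarU F p = m * (m * (p : ℝ)⁻¹) := by
    simp_rw [frob_self]
    have hi : ∀ i j, Integrable (fun k : U F p => ‖blk k i j‖ ^ 2) (haarU F p) := fun i j =>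
      integrable_haarU ((hblk.matrix_elem i j).norm.pow 2)
    rw [integral_finsetSum _ fun j _ => integrable_finsetSum _ fun i _ => hi i j]
    simp_rw [fun j => integral_finsetSum (μ := haarU F p) Finset.univ fun i _ => hi i j]
    simp only [blk, submatrix_apply, integral_norm_sq_entry]
    simp
  simp_rw [hgram]
  have hdiff : (∫ k : U F p, f (arg (blk k)) ∂haarU F p) - f (xᴴ * x + yᴴ * y) =
      ∫ k : U F p, (f (arg (blk k)) - f (xᴴ * x + yᴴ * y)) ∂haarU F p := by
    rw [integral_sub (integrable_haarU hcont) (integrable_const _)]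
    simp
  rw [dist_eq_norm, hdiff]
  calc _ ≤ ∫ k : U F p, (ε / 2 + C * frob (blk k) (blk k)) ∂haarU F p :=
        norm_integral_le_of_norm_le (integrable_haarU
          (continuous_const.add (continuous_const.mul (continuous_frob_self.comp hblk))))
          (Eventually.of_forall fun k => hbound _ (hblkS k))
    _ = ε / 2 + C * (m * (m * (p : ℝ)⁻¹)) := by
        rw [integral_add (integrable_const _) (integrable_haarU (f := fun k => C * frob (blk k) (blk k))
          (continuous_const.mul (continuous_frob_self.comp hblk))), integral_const_mul, hfrob]
        simp
    _ < ε := hP p ((le_max_left _ _).trans hp)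

end concentration

end OlshanskiMotion

namespace OlshanskiMotion

variable {F : Type} [NormedDivisionRing F] [StarRing F] [NormedAlgebra ℝ F] [CStarRing F]
variable {q : ℕ}

/-! ### Calculus in the inductive limit -/

section limitGroup

theorem toGInf_mul {p : ℕ} (g h : G F q p) :
    toGInf F q p (g * h) = toGInf F q p g * toGInf F q p h :=
  (DirectLimit.mul_def p g h).symm

theorem toGInf_inv {p : ℕ} (g : G F q p) : toGInf F q p g⁻¹ = (toGInf F q p g)⁻¹ :=
  (DirectLimit.inv_def p g).symm

theorem toGInf_one (p : ℕ) : toGInf F q p 1 = 1 := (DirectLimit.one_def p).symm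

theorem toGInf_emb {m n : ℕ} (h : m ≤ n) (g : G F q m) :
    toGInf F q n (emb F q m n h g) = toGInf F q m g :=
  DirectLimit.mk_apply m n g h

/-- A matrix `x`, as the element `(x, 1)` of `G_∞`. -/
def ofM {p : ℕ} (x : Matrix (Fin p) (Fin q) F) : GInf F q :=
  toGInf F q p (SemidirectProduct.inl (.ofAdd x))

theorem ofM_padRows {m n : ℕ} (h : m ≤ n) (x : Matrix (Fin m) (Fin q) F) :
    ofM (padRows n x) = ofM x := by
  rw [ofM, ofM, ← toGInf_emb h, emb, SemidirectProduct.map_inl]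
  rfl

theorem ofU_embU {m n : ℕ} (h : m ≤ n) (u : U F m) : ofU F q n (embU h u) = ofU F q m u := by
  rw [ofU, ofU, ← toGInf_emb h, emb, SemidirectProduct.map_inr]

theorem ofM_add {p : ℕ} (x y : Matrix (Fin p) (Fin q) F) : ofM (x + y) = ofM x * ofM y := by
  rw [ofM, ofM, ofM, ← toGInf_mul, ofAdd_add, map_mul]

theorem ofM_neg {p : ℕ} (x : Matrix (Fin p) (Fin q) F) : ofM (-x) = (ofM x)⁻¹ := by
  rw [ofM, ofM, ← toGInf_inv, ofAdd_neg, map_inv]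

theorem ofM_zero (p : ℕ) : ofM (0 : Matrix (Fin p) (Fin q) F) = 1 := by
  rw [ofM, ofAdd_zero, map_one, toGInf_one]

theorem ofU_mul_ofM {p : ℕ} (u : U F p) (x : Matrix (Fin p) (Fin q) F) :
    ofU F q p u * ofM x = ofM (u.1 * x) * ofU F q p u := by
  rw [ofU, ofM, ofM, ← toGInf_mul, ← toGInf_mul]
  congr 1
  have := SemidirectProduct.inl_aut (φ := leftAction F p q) u (.ofAdd x)
  rw [map_inv, eq_mul_inv_iff_mul_eq] at this
  exact this.symm

theorem ofU_inv {p : ℕ} (u : U F p) : ofU F q p u⁻¹ = (ofU F q p u)⁻¹ := by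
  rw [ofU, ofU, ← toGInf_inv, map_inv]

theorem toGInf_eq_ofM_mul_ofU {p : ℕ} (g : G F q p) :
    toGInf F q p g = ofM g.left.toAdd * ofU F q p g.right := by
  rw [ofM, ofU, ← toGInf_mul, ofAdd_toAdd, SemidirectProduct.inl_left_mul_inr_right]

theorem toGInf_eq_ofU_mul_ofM {p : ℕ} (g : G F q p) :
    toGInf F q p g = ofU F q p g.right * ofM ((g.right⁻¹).1 * g.left.toAdd) := by
  rw [ofU_mul_ofM, ← Matrix.mul_assoc, ← Submonoid.coe_mul, mul_inv_cancel, Submonoid.coe_one,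
    Matrix.one_mul, toGInf_eq_ofM_mul_ofU]

/-- Finitely many elements live in one `G_p`. The unitary factor stands on the left so that in `g_k
g_l⁻¹` both unitary factors are outermost. -/
theorem exists_eq_ofU_mul_ofM {n : ℕ} (g : Fin n → GInf F q) :
    ∃ (p : ℕ) (u : Fin n → U F p) (x : Fin n → Matrix (Fin p) (Fin q) F),
      ∀ i, g i = ofU F q p (u i) * ofM (x i) := by
  choose s y hy using fun i => DirectLimit.exists_eq_mk (emb F q) (g i)
  let p := Finset.univ.sup s
  have hp : ∀ i, s i ≤ p := fun i => Finset.le_sup (Finset.mem_univ i)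
  refine ⟨p, fun i => (emb F q _ p (hp i) (y i)).right,
    fun i => ((emb F q _ p (hp i) (y i)).right⁻¹).1 *
      (emb F q _ p (hp i) (y i)).left.toAdd, fun i => ?_⟩
  rw [← toGInf_eq_ofU_mul_ofM, toGInf_emb, hy]
  rfl

theorem continuous_toGInf (p : ℕ) : Continuous (toGInf F q p) :=
  continuous_iSup_rng (i := p) continuous_coinduced_rng

theorem continuous_GInf_iff {X : Type} [TopologicalSpace X] {f : GInf F q → X} :
    Continuous f ↔ ∀ p, Continuous fun g => f (toGInf F q p g) := by
  rw [continuous_iSup_dom]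
  exact forall_congr' fun p => continuous_coinduced_dom

theorem continuous_ofM (p : ℕ) :
    Continuous (ofM : Matrix (Fin p) (Fin q) F → GInf F q) := by
  refine (continuous_toGInf p).comp (continuous_induced_rng.2 ?_)
  exact continuous_ofAdd.prodMk continuous_const

theorem ofU_mem_KInf {p : ℕ} (u : U F p) : ofU F q p u ∈ KInf F q := ⟨p, u, rfl⟩

end limitGroup

/-! ### Biinvariant functions and multiplicativity -/

section biinvariant

variable {φ : GInf F q → ℂ}

theorem one_mem_KInf : (1 : GInf F q) ∈ KInf F q :=
  ⟨0, 1, by rw [ofU, map_one, toGInf_one]⟩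

theorem IsBiinvariant.mul_left (hφ : IsBiinvariant φ) {p : ℕ} (u : U F p) (g : GInf F q) :
    φ (ofU F q p u * g) = φ g := by
  simpa using hφ _ (ofU_mem_KInf u) _ one_mem_KInf g

theorem IsBiinvariant.mul_right (hφ : IsBiinvariant φ) {p : ℕ} (u : U F p) (g : GInf F q) :
    φ (g * ofU F q p u) = φ g := by
  simpa using hφ _ one_mem_KInf _ (ofU_mem_KInf u) g

theorem IsBiinvariant.toGInf (hφ : IsBiinvariant φ) {p : ℕ} (g : G F q p) :
    φ (toGInf F q p g) = φ (ofM g.left.toAdd) := by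
  rw [toGInf_eq_ofM_mul_ofU, hφ.mul_right]

theorem IsBiinvariant.ofM_unitary_mul (hφ : IsBiinvariant φ) {p : ℕ} (u : U F p)
    (x : Matrix (Fin p) (Fin q) F) : φ (ofM (u.1 * x)) = φ (ofM x) := by
  rw [← hφ.mul_right u, ← ofU_mul_ofM, hφ.mul_left]

variable [ClassicalField F]

/-- After padding to a common size, `x` and `y` lie in one unitary orbit, and left multiplication by
`u` is conjugation in the group. -/
theorem IsBiinvariant.ofM_eq (hφ : IsBiinvariant φ) {m n : ℕ} {x : Matrix (Fin m) (Fin q) F}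
    {y : Matrix (Fin n) (Fin q) F} (h : xᴴ * x = yᴴ * y) : φ (ofM x) = φ (ofM y) := by
  rw [← ofM_padRows (le_max_left m n) x, ← ofM_padRows (le_max_right m n) y]
  obtain ⟨u, hu⟩ := exists_unitary_mul_eq (x := padRows (max m n) x) (y := padRows (max m n) y)
    (by rw [conjTranspose_padRows_mul_padRows (le_max_left m n),
      conjTranspose_padRows_mul_padRows (le_max_right m n), h])
  rw [← hu, hφ.ofM_unitary_mul]

open Classical in
/-- A biinvariant function, as a function of the Gram matrix `x* x`. -/
def profile (φ : GInf F q → ℂ) (r : Matrix (Fin q) (Fin q) F) : ℂ :=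
  -- Such `r` are exactly the cone elements; the default `0` outside it is never used.
  if h : ∃ x : Matrix (Fin q) (Fin q) F, xᴴ * x = r then φ (ofM h.choose) else 0

theorem exists_sqrt_gram {p : ℕ} (x : Matrix (Fin p) (Fin q) F) :
    ∃ a ∈ posCone F q, a ^ 2 = xᴴ * x ∧ aᴴ * a = xᴴ * x := by
  obtain ⟨a, ha, hax⟩ := exists_sqrt_mem_posCone (conjTranspose_mul_self_mem_posCone x)
  exact ⟨a, ha, hax, by rw [conjTranspose_of_mem_posCone ha, ← pow_two, hax]⟩

theorem IsBiinvariant.profile_gram (hφ : IsBiinvariant φ) {p : ℕ}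
    (x : Matrix (Fin p) (Fin q) F) : profile φ (xᴴ * x) = φ (ofM x) := by
  obtain ⟨a, -, -, ha⟩ := exists_sqrt_gram x
  have h : ∃ y : Matrix (Fin q) (Fin q) F, yᴴ * y = xᴴ * x := ⟨a, ha⟩
  rw [profile, dif_pos h]
  exact hφ.ofM_eq h.choose_spec

theorem exists_gram_eq {r : Matrix (Fin q) (Fin q) F} (hr : r ∈ posCone F q) :
    ∃ x : Matrix (Fin q) (Fin q) F, xᴴ * x = r := by
  obtain ⟨s, hs, rfl⟩ := exists_sqrt_mem_posCone hr
  exact ⟨s, by rw [conjTranspose_of_mem_posCone hs, pow_two]⟩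

/-- The Gram map is proper, since the trace of `x* x` bounds every entry of `x`. -/
theorem isClosedMap_gram :
    IsClosedMap fun x : Matrix (Fin q) (Fin q) F => xᴴ * x := by
  have hc : Continuous fun x : Matrix (Fin q) (Fin q) F => xᴴ * x := by fun_prop
  have : FiniteDimensional ℝ F := ClassicalField.finiteDimensional
  have : ProperSpace F := FiniteDimensional.proper ℝ F
  have : LocallyCompactSpace (Matrix (Fin q) (Fin q) F) :=
    inferInstanceAs (LocallyCompactSpace (Fin q → Fin q → F))
  refine (isProperMap_iff_isCompact_preimage.2 ⟨hc, fun K hK => ?_⟩).isClosedMap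
  have hcr : Continuous fun r : Matrix (Fin q) (Fin q) F => ClassicalField.re r.trace :=
    continuous_re.comp (Continuous.matrix_trace continuous_id)
  obtain ⟨R, hR⟩ := hK.exists_bound_of_continuousOn hcr.continuousOn
  refine (isCompact_entry_le (√R)).of_isClosed_subset (hK.isClosed.preimage hc) fun x hx i j => ?_
  apply Real.le_sqrt_of_sq_le
  exact (norm_sq_entry_le x i j).trans ((le_abs_self _).trans (hR _ hx))

/-- The Gram map is closed and onto the cone, so continuity descends: preimages of closed sets under
`profile φ` are Gram images of closed sets. -/
theorem continuousOn_profile (hc : Continuous φ) (hφ : IsBiinvariant φ) :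
    ContinuousOn (profile φ) (posCone F q) := by
  rw [continuousOn_iff_isClosed]
  intro t ht
  refine ⟨_, isClosedMap_gram _ (ht.preimage (hc.comp (continuous_ofM q))), ?_⟩
  ext r
  constructor
  · rintro ⟨hrt, hr⟩
    obtain ⟨x, rfl⟩ := exists_gram_eq hr
    refine ⟨⟨x, ?_, rfl⟩, hr⟩
    rw [Set.mem_preimage, hφ.profile_gram] at hrt
    exact hrt
  · rintro ⟨⟨x, hx, rfl⟩, hr⟩
    refine ⟨?_, hr⟩
    rw [Set.mem_preimage, hφ.profile_gram]
    exact hx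

theorem tendsto_integral_biinvariant (hc : Continuous φ) (hφ : IsBiinvariant φ) {m : ℕ}
    (u v : U F m) (x y : Matrix (Fin m) (Fin q) F) :
    Tendsto (fun p : ℕ => ∫ k : U F p,
      φ (ofU F q m u * ofM x * ofU F q p k * (ofM y * ofU F q m v)) ∂(haarU F p)) atTop
      (𝓝 (profile φ (xᴴ * x + yᴴ * y))) := by
  refine (tendsto_integral_gram (continuousOn_profile hc hφ) x y).congr' ?_
  filter_upwards [eventually_ge_atTop m] with p hp
  refine integral_congr_ae (Eventually.of_forall fun k => ?_)
  change profile φ _ = φ _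
  rw [hφ.profile_gram, ← mul_assoc, hφ.mul_right, mul_assoc, mul_assoc, hφ.mul_left,
    ← ofM_padRows hp y, ofU_mul_ofM, ← mul_assoc, hφ.mul_right, ← ofM_padRows hp x, ← ofM_add]

/-- For continuous biinvariant functions, Olshanski sphericality means multiplicativity in the
Gram matrix. -/
theorem isOlshanskiSpherical_iff (hc : Continuous φ) (hφ : IsBiinvariant φ) :
    IsOlshanskiSpherical φ ↔ φ ≠ 0 ∧ ∀ r ∈ posCone F q, ∀ s ∈ posCone F q,
      profile φ (r + s) = profile φ r * profile φ s := by
  constructor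
  · intro h
    refine ⟨h.ne_zero, fun r hr s hs => ?_⟩
    obtain ⟨x, rfl⟩ := exists_gram_eq hr
    obtain ⟨y, rfl⟩ := exists_gram_eq hs
    have h1 := tendsto_integral_biinvariant hc hφ 1 1 x y
    have h2 := h.product_formula (ofU F q q 1 * ofM x) (ofM y * ofU F q q 1)
    rw [hφ.mul_left, hφ.mul_right] at h2
    rw [hφ.profile_gram, hφ.profile_gram]
    exact tendsto_nhds_unique h1 h2
  · rintro ⟨h0, hmul⟩
    refine ⟨h0, hc, hφ, fun g h => ?_⟩
    obtain ⟨m, g, h, rfl, rfl⟩ := DirectLimit.exists_eq_mk₂ (emb F q) g h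
    change Tendsto (fun p : ℕ => ∫ k : U F p, φ (toGInf F q m g * _ * toGInf F q m h) ∂_) _
      (𝓝 (φ (toGInf F q m g) * φ (toGInf F q m h)))
    rw [toGInf_eq_ofU_mul_ofM g, toGInf_eq_ofM_mul_ofU h, hφ.mul_left, hφ.mul_right,
      ← hφ.profile_gram, ← hφ.profile_gram (h.left.toAdd),
      ← hmul _ (conjTranspose_mul_self_mem_posCone _) _ (conjTranspose_mul_self_mem_posCone _)]
    exact tendsto_integral_biinvariant hc hφ _ _ _ _

end biinvariant

end OlshanskiMotion

namespace OlshanskiMotion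

variable {F : Type} [NormedDivisionRing F] [StarRing F] [NormedAlgebra ℝ F] [CStarRing F]
variable [ClassicalField F] {q : ℕ}

/-! ### Additive functions on the cone -/

section additive

variable {Λ : Matrix (Fin q) (Fin q) F → ℝ}

/-- The square of `(h + c) / 2`, where `h` is the Hermitian part of `x`. -/
def shiftSq (c : ℝ) (x : Matrix (Fin q) (Fin q) F) : Matrix (Fin q) (Fin q) F :=
  ((2 : ℝ)⁻¹ • ((2 : ℝ)⁻¹ • (x + xᴴ) + c • (1 : Matrix (Fin q) (Fin q) F)))ᴴ *
    ((2 : ℝ)⁻¹ • ((2 : ℝ)⁻¹ • (x + xᴴ) + c • (1 : Matrix (Fin q) (Fin q) F)))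

theorem shiftSq_mem (c : ℝ) (x : Matrix (Fin q) (Fin q) F) : shiftSq c x ∈ posCone F q :=
  conjTranspose_mul_self_mem_posCone _

/-- This is `((h + 1) / 2) ^ 2 - ((h - 1) / 2) ^ 2 = h`: the Hermitian part is a difference of two
cone elements depending continuously on `x`. -/
theorem shiftSq_one_eq (x : Matrix (Fin q) (Fin q) F) :
    shiftSq 1 x = shiftSq (-1) x + (2 : ℝ)⁻¹ • (x + xᴴ) := by
  have hh : ((2 : ℝ)⁻¹ • (x + xᴴ))ᴴ = (2 : ℝ)⁻¹ • (x + xᴴ) := by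
    rw [conjTranspose_smul, conjTranspose_add, conjTranspose_conjTranspose, star_trivial, add_comm]
  simp only [shiftSq]
  generalize (2 : ℝ)⁻¹ • (x + xᴴ) = h at hh
  simp only [conjTranspose_smul, conjTranspose_add, conjTranspose_one, hh, star_trivial,
    Matrix.smul_mul, Matrix.mul_smul, Matrix.add_mul, Matrix.mul_add, Matrix.one_mul,
    Matrix.mul_one]
  module

/-- The extension to all matrices of an additive function on the cone. -/
def coneExtension (Λ : Matrix (Fin q) (Fin q) F → ℝ) (x : Matrix (Fin q) (Fin q) F) : ℝ :=
  Λ (shiftSq 1 x) - Λ (shiftSq (-1) x)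

theorem coneExtension_add
    (hadd : ∀ r ∈ posCone F q, ∀ s ∈ posCone F q, Λ (r + s) = Λ r + Λ s)
    (x y : Matrix (Fin q) (Fin q) F) :
    coneExtension Λ (x + y) = coneExtension Λ x + coneExtension Λ y := by
  -- Negative terms are moved across, so that additivity is only used inside the cone.
  have h : shiftSq 1 (x + y) + (shiftSq (-1) x + shiftSq (-1) y) =
      shiftSq (-1) (x + y) + (shiftSq 1 x + shiftSq 1 y) := by
    rw [shiftSq_one_eq, shiftSq_one_eq, shiftSq_one_eq, conjTranspose_add]
    module
  have h2 := congrArg Λ h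
  rw [hadd _ (shiftSq_mem _ _) _ (add_mem_posCone (shiftSq_mem _ _) (shiftSq_mem _ _)),
    hadd _ (shiftSq_mem _ _) _ (add_mem_posCone (shiftSq_mem _ _) (shiftSq_mem _ _)),
    hadd _ (shiftSq_mem _ _) _ (shiftSq_mem _ _), hadd _ (shiftSq_mem _ _) _ (shiftSq_mem _ _)]
    at h2
  simp only [coneExtension]
  linarith

theorem coneExtension_of_mem
    (hadd : ∀ r ∈ posCone F q, ∀ s ∈ posCone F q, Λ (r + s) = Λ r + Λ s)
    {r : Matrix (Fin q) (Fin q) F} (hr : r ∈ posCone F q) : coneExtension Λ r = Λ r := by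
  have h : (2 : ℝ)⁻¹ • (r + rᴴ) = r := by
    rw [conjTranspose_of_mem_posCone hr]
    module
  rw [coneExtension, shiftSq_one_eq, h, hadd _ (shiftSq_mem _ _) _ hr, add_sub_cancel_left]

theorem coneExtension_conjTranspose (x : Matrix (Fin q) (Fin q) F) :
    coneExtension Λ xᴴ = coneExtension Λ x := by
  simp only [coneExtension, shiftSq, conjTranspose_conjTranspose, add_comm xᴴ]

/-- Continuous nonnegative additive functions on the cone are scalar products with elements of the
cone. -/
theorem exists_frob_of_additive (hcont : Continuous fun x : Matrix (Fin q) (Fin q) F => Λ (xᴴ * x))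
    (hadd : ∀ r ∈ posCone F q, ∀ s ∈ posCone F q, Λ (r + s) = Λ r + Λ s)
    (hpos : ∀ r ∈ posCone F q, 0 ≤ Λ r) :
    ∃ b ∈ posCone F q, ∀ r ∈ posCone F q, Λ r = frob b r := by
  have hc : ∀ c : ℝ, Continuous fun x : Matrix (Fin q) (Fin q) F => Λ (shiftSq c x) := fun c =>
    hcont.comp (g := fun x : Matrix (Fin q) (Fin q) F => Λ (xᴴ * x))
      (f := fun x => (2 : ℝ)⁻¹ • ((2 : ℝ)⁻¹ • (x + xᴴ) + c • (1 : Matrix (Fin q) (Fin q) F)))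
      (by fun_prop)
  -- Continuity upgrades additivity to real linearity.
  let ℓ : Matrix (Fin q) (Fin q) F →+ ℝ := AddMonoidHom.mk' (coneExtension Λ)
    (coneExtension_add hadd)
  have hℓ : Continuous ℓ := (hc 1).sub (hc (-1))
  obtain ⟨b, hb⟩ := exists_frob_representation (ℓ.toRealLinearMap hℓ).toLinearMap
  replace hb : ∀ x, coneExtension Λ x = frob b x := hb
  have hbr : ∀ r ∈ posCone F q, Λ r = frob b r := fun r hr => by
    rw [← hb, coneExtension_of_mem hadd hr]
  refine ⟨b, mem_posCone_iff.2 ⟨?_, fun x => ?_⟩, hbr⟩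
  -- The extension sees only Hermitian parts, so `b* - b` is orthogonal to everything.
  · have h : ∀ x, frob (bᴴ + (-1 : ℝ) • b) x = 0 := by
      intro x
      have h1 : frob bᴴ x = frob b x := by
        rw [← frob_conjTranspose, conjTranspose_conjTranspose, ← hb, coneExtension_conjTranspose,
          hb]
      rw [frob_add_left, frob_smul_left, h1]
      ring
    have h2 := eq_zero_of_frob_self _ (h _)
    rwa [neg_one_smul, ← sub_eq_add_neg, sub_eq_zero] at h2
  -- Self-duality: nonnegativity at `x x*` is nonnegativity of the quadratic form of `b` at `x`.
  · have hx : x * xᴴ ∈ posCone F q := by simpa using conjTranspose_mul_self_mem_posCone xᴴ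
    have h1 := hpos _ hx
    rw [hbr _ hx, frob_comm, frob, conjTranspose_mul, conjTranspose_conjTranspose,
      Matrix.mul_assoc, re_trace_mul_comm] at h1
    rwa [frob, ← Matrix.mul_assoc]

end additive

/-! ### From positive definite spherical functions to the cone -/

section positiveDefinite

variable {φ : GInf F q → ℂ}

-- `x` and `-x` have the same Gram matrix, so testing on `1` and `x` with coefficients `(1, ±1)`
-- gives `2 (1 ± φ x) ≥ 0`.
open scoped ComplexOrder in
theorem IsPositiveDefinite.ofM_real_le_one (hpd : IsPositiveDefinite φ) (hφ : IsBiinvariant φ)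
    (h1 : φ 1 = 1) {p : ℕ} (x : Matrix (Fin p) (Fin q) F) :
    φ (ofM x) = ((φ (ofM x)).re : ℂ) ∧ (φ (ofM x)).re ≤ 1 := by
  have hinv : φ (ofM x)⁻¹ = φ (ofM x) := by
    rw [← ofM_neg]
    exact hφ.ofM_eq (by simp)
  have hp := hpd 2 ![1, ofM x] ![1, 1]
  have hm := hpd 2 ![1, ofM x] ![1, -1]
  simp only [Fin.sum_univ_two, cons_val_zero, cons_val_one, inv_one, mul_one, mul_inv_cancel,
    one_mul, h1, hinv, map_one, map_neg, mul_neg, neg_mul, neg_neg] at hp hm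
  rw [Complex.le_def] at hp hm
  simp at hp hm
  refine ⟨Complex.ext rfl ?_, by linarith [hm.1]⟩
  rw [Complex.ofReal_im]
  linarith [hp.2]

/-- A positive definite spherical function is `exp (-⟨x* x, b⟩)` for some `b` in the cone. -/
theorem IsOlshanskiSpherical.exists_represents (hs : IsOlshanskiSpherical φ)
    (hpd : IsPositiveDefinite φ) : ∃ b ∈ posCone F q, Represents φ (psi b) := by
  have hφ := hs.biinvariant
  have hc := hs.continuous
  have hmul := ((isOlshanskiSpherical_iff hc hφ).1 hs).2
  have h0mem : (0 : Matrix (Fin q) (Fin q) F) ∈ posCone F q := by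
    simpa using conjTranspose_mul_self_mem_posCone (0 : Matrix (Fin q) (Fin q) F)
  have hp0 : profile φ (0 : Matrix (Fin q) (Fin q) F) = φ 1 := by
    simpa [ofM_zero] using hφ.profile_gram (0 : Matrix (Fin q) (Fin q) F)
  have h1 : φ 1 = 1 := by
    obtain ⟨g, hg⟩ := Function.ne_iff.1 hs.ne_zero
    obtain ⟨p, g, rfl⟩ := DirectLimit.exists_eq_mk (emb F q) g
    change φ (toGInf F q p g) ≠ 0 at hg
    rw [hφ.toGInf, ← hφ.profile_gram] at hg
    have := hmul _ (conjTranspose_mul_self_mem_posCone g.left.toAdd) 0 h0mem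
    rw [add_zero, hp0] at this
    exact mul_left_cancel₀ hg (by rw [← this, mul_one])
  let ρ : Matrix (Fin q) (Fin q) F → ℝ := fun x => (φ (ofM x)).re
  have hρ : ∀ x, φ (ofM x) = (ρ x : ℂ) := fun x => (hpd.ofM_real_le_one hφ h1 x).1
  have hρ1 : ∀ x, ρ x ≤ 1 := fun x => (hpd.ofM_real_le_one hφ h1 x).2
  have hρc : Continuous ρ := Complex.continuous_re.comp (hc.comp (continuous_ofM q))
  have hρ0 : ρ 0 = 1 := by simp [ρ, ofM_zero, h1]
  -- Scaling by `1 / √2` halves the Gram matrix, so `ρ` is a square.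
  have hhalf : ∀ x, ρ x = ρ ((√2)⁻¹ • x) ^ 2 := by
    intro x
    have h := hmul _ (conjTranspose_mul_self_mem_posCone ((√2)⁻¹ • x)) _
      (conjTranspose_mul_self_mem_posCone ((√2)⁻¹ • x))
    have h2 : ((√2)⁻¹ • x)ᴴ * ((√2)⁻¹ • x) + ((√2)⁻¹ • x)ᴴ * ((√2)⁻¹ • x) = xᴴ * x := by
      rw [conjTranspose_smul, star_trivial, Matrix.smul_mul, Matrix.mul_smul, smul_smul,
        ← mul_inv, Real.mul_self_sqrt zero_le_two, ← add_smul]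
      norm_num
    rw [h2, hφ.profile_gram, hφ.profile_gram, hρ, hρ] at h
    rw [pow_two]
    exact_mod_cast h
  have hpos : ∀ x, 0 < ρ x := by
    intro x
    refine lt_of_le_of_ne (by rw [hhalf]; positivity) fun hx => ?_
    -- A zero would propagate along `x / √2 ^ n`, which tends to `0`, where `ρ` equals `1`.
    have hz : ∀ n : ℕ, ρ ((√2)⁻¹ ^ n • x) = 0 := by
      intro n
      induction n with
      | zero => simpa using hx.symm
      | succ n ih =>
        rw [hhalf] at ih
        rw [pow_succ', mul_smul]
        exact pow_eq_zero_iff two_ne_zero |>.1 ih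
    have hlt : (√2)⁻¹ < 1 := inv_lt_one_of_one_lt₀ (by
      rw [Real.lt_sqrt zero_le_one]
      norm_num)
    have ht : Tendsto (fun n : ℕ => ρ ((√2)⁻¹ ^ n • x)) atTop (𝓝 (ρ ((0 : ℝ) • x))) :=
      (hρc.tendsto _).comp
        ((tendsto_pow_atTop_nhds_zero_of_lt_one (by positivity) hlt).smul_const x)
    simp_rw [hz, zero_smul, hρ0] at ht
    exact zero_ne_one (tendsto_nhds_unique tendsto_const_nhds ht)
  let Λ : Matrix (Fin q) (Fin q) F → ℝ := fun r => -Real.log (profile φ r).re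
  have hΛ : ∀ x, Λ (xᴴ * x) = -Real.log (ρ x) := fun x => by
    simp only [Λ, hφ.profile_gram]
    rfl
  obtain ⟨b, hb, hbΛ⟩ := exists_frob_of_additive (Λ := Λ)
    (by simp_rw [hΛ]; exact (hρc.log fun x => (hpos x).ne').neg)
    (by
      intro r hr s hs'
      have h := hmul r hr s hs'
      obtain ⟨x, rfl⟩ := exists_gram_eq hr
      obtain ⟨y, rfl⟩ := exists_gram_eq hs'
      rw [hΛ, hΛ]
      simp only [Λ]
      rw [h, hφ.profile_gram, hφ.profile_gram, hρ, hρ, ← Complex.ofReal_mul, Complex.ofReal_re,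
        Real.log_mul (hpos _).ne' (hpos _).ne']
      ring)
    (by
      intro r hr
      obtain ⟨x, rfl⟩ := exists_gram_eq hr
      rw [hΛ]
      exact neg_nonneg.2 (Real.log_nonpos (hpos x).le (hρ1 x)))
  refine ⟨b, hb, hc, hφ, fun a => ?_⟩
  have ha := conjTranspose_of_mem_posCone a.2
  have ha2 : a.1ᴴ * a.1 = a.1 ^ 2 := by rw [ha, pow_two]
  have h := hbΛ _ (conjTranspose_mul_self_mem_posCone a.1)
  rw [hΛ, frob, conjTranspose_of_mem_posCone hb, re_trace_mul_comm, ha2] at h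
  change φ (ofM a.1) = Complex.exp (-(ClassicalField.re (a.1 ^ 2 * b).trace : ℂ))
  rw [hρ, ← h, ← Complex.ofReal_neg, neg_neg, ← Complex.ofReal_exp, Real.exp_log (hpos _)]

end positiveDefinite

/-! ### Existence, uniqueness and the converse -/

section represents

variable {φ : GInf F q → ℂ} {b : Matrix (Fin q) (Fin q) F}

theorem Represents.apply_ofM (h : Represents φ (psi b)) {p : ℕ} (x : Matrix (Fin p) (Fin q) F) :
    φ (ofM x) = Complex.exp (-(scalarProduct (xᴴ * x) b : ℂ)) := by
  obtain ⟨a, ha, hax, hax'⟩ := exists_sqrt_gram x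
  rw [h.biinvariant.ofM_eq hax'.symm, ← hax]
  exact h.apply_gOf ⟨a, ha⟩

theorem Represents.isOlshanskiSpherical (h : Represents φ (psi b)) : IsOlshanskiSpherical φ := by
  refine (isOlshanskiSpherical_iff h.continuous h.biinvariant).2 ⟨fun h0 => ?_, ?_⟩
  · have := h.apply_ofM (0 : Matrix (Fin q) (Fin q) F)
    rw [h0] at this
    exact Complex.exp_ne_zero _ this.symm
  · have hp : ∀ r ∈ posCone F q, profile φ r = Complex.exp (-(scalarProduct r b : ℂ)) := by
      intro r hr
      obtain ⟨x, rfl⟩ := exists_gram_eq hr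
      rw [h.biinvariant.profile_gram, h.apply_ofM]
    intro r hr s hs
    rw [hp _ hr, hp _ hs, hp _ (add_mem_posCone hr hs), ← Complex.exp_add, ← neg_add,
      ← Complex.ofReal_add, scalarProduct, Matrix.add_mul, trace_add, re_add]
    rfl

-- For `b = t ^ 2`, cyclicity of the real trace turns the exponent at `x - y` into minus the squared
-- Frobenius norm of `x t - y t`.
open scoped ComplexOrder in
theorem Represents.isPositiveDefinite (hb : b ∈ posCone F q) (h : Represents φ (psi b)) :
    IsPositiveDefinite φ := by
  intro n g c
  obtain ⟨p, u, x, hg⟩ := exists_eq_ofU_mul_ofM g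
  obtain ⟨t, ht, rfl⟩ := hb
  have hφ : ∀ k l, φ (g k * (g l)⁻¹) =
      Complex.exp (-((frob (x k * t - x l * t) (x k * t - x l * t) : ℝ) : ℂ)) := by
    intro k l
    rw [hg, hg, _root_.mul_inv_rev, ← ofM_neg, ← ofU_inv, ← mul_assoc, h.biinvariant.mul_right,
      mul_assoc, h.biinvariant.mul_left, ← ofM_add, h.apply_ofM, ← sub_eq_add_neg,
      ← Matrix.sub_mul, frob, scalarProduct, conjTranspose_mul, ht, Matrix.mul_assoc t,
      re_trace_mul_comm t, ← Matrix.mul_assoc, Matrix.mul_assoc _ t t, ← pow_two]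
  obtain ⟨r, hr, hsum⟩ := frob_gaussian_kernel_nonneg (fun k => x k * t) c
  simp_rw [hφ, hsum]
  exact_mod_cast hr

/-- The function `exp (-⟨x* x, b⟩)` on the inductive limit. -/
def gaussianFn (b : Matrix (Fin q) (Fin q) F) : GInf F q → ℂ :=
  DirectLimit.lift (emb F q)
    (fun _ g => Complex.exp (-(scalarProduct (g.left.toAddᴴ * g.left.toAdd) b : ℂ)))
    fun m n h g => by
      change _ = Complex.exp (-(scalarProduct ((padRows n g.left.toAdd)ᴴ *
        padRows n g.left.toAdd) b : ℂ))
      rw [conjTranspose_padRows_mul_padRows h]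

theorem gaussianFn_toGInf {p : ℕ} (g : G F q p) : gaussianFn b (toGInf F q p g) =
    Complex.exp (-(scalarProduct (g.left.toAddᴴ * g.left.toAdd) b : ℂ)) := rfl

theorem represents_gaussianFn (b : Matrix (Fin q) (Fin q) F) :
    Represents (gaussianFn b) (psi b) where
  continuous := by
    rw [continuous_GInf_iff]
    intro p
    simp_rw [gaussianFn_toGInf]
    have hleft : Continuous fun g : G F q p => g.left.toAdd :=
      continuous_toAdd.comp (continuous_fst.comp
        (continuous_induced_dom (f := fun g : G F q p => (g.left, g.right))))
    have : Continuous fun g : G F q p => scalarProduct (g.left.toAddᴴ * g.left.toAdd) b :=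
      continuous_re.comp (Continuous.matrix_trace
        ((hleft.matrix_conjTranspose.matrix_mul hleft).matrix_mul continuous_const))
    fun_prop
  biinvariant := by
    rintro k ⟨m, u, rfl⟩ l ⟨n, v, rfl⟩ g
    obtain ⟨s, g, rfl⟩ := DirectLimit.exists_eq_mk (emb F q) g
    change gaussianFn b (_ * toGInf F q s g * _) = gaussianFn b (toGInf F q s g)
    -- All three factors are moved to a common level, where left multiplication by `u` preserves the
    -- Gram matrix.
    have h1 : m ≤ m + n + s := by omega
    have h2 : n ≤ m + n + s := by omega
    have h3 : s ≤ m + n + s := by omega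
    rw [← toGInf_emb h3 g, ← ofU_embU h1 u, ← ofU_embU h2 v]
    generalize emb F q _ _ h3 g = g, embU h1 u = u, embU h2 v = v
    rw [ofU, ofU, ← toGInf_mul, ← toGInf_mul, gaussianFn_toGInf, gaussianFn_toGInf]
    have hl : (SemidirectProduct.inr u * g * SemidirectProduct.inr v).left.toAdd =
        u.1 * g.left.toAdd := by
      simp only [SemidirectProduct.mul_left, SemidirectProduct.left_inr, map_one, mul_one,
        one_mul, SemidirectProduct.right_inr]
      rfl
    rw [hl, conjTranspose_mul_self_unitary_mul]
  apply_gOf a := by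
    change Complex.exp (-(scalarProduct (a.1ᴴ * a.1) b : ℂ)) = _
    rw [conjTranspose_of_mem_posCone a.2, ← pow_two]
    rfl

theorem Represents.unique {ψ : GInf F q → ℂ} (hφ : Represents φ (psi b))
    (hψ : Represents ψ (psi b)) : φ = ψ := by
  ext g
  obtain ⟨p, g, rfl⟩ := DirectLimit.exists_eq_mk (emb F q) g
  exact (hφ.biinvariant.toGInf g).trans ((hφ.apply_ofM _).trans
    ((hψ.apply_ofM _).symm.trans (hψ.biinvariant.toGInf g).symm))

end represents

variable (F) in
/-- Classification of the positive definite Olshanski spherical functions over a classical field. -/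
theorem positiveDefinite_spherical_classification (q : ℕ) :
    ({φ : GInf F q → ℂ | IsOlshanskiSpherical φ ∧ IsPositiveDefinite φ} =
        {φ : GInf F q → ℂ | ∃ b ∈ posCone F q, Represents φ (psi b)}) ∧
      ∀ b ∈ posCone F q, ∃! φ : GInf F q → ℂ, Represents φ (psi b) := by
  refine ⟨Set.ext fun φ => ⟨fun h => h.1.exists_represents h.2, ?_⟩, fun b _ =>
    ⟨_, represents_gaussianFn b, fun φ hφ => hφ.unique (represents_gaussianFn b)⟩⟩
  rintro ⟨b, hb, h⟩
  exact ⟨h.isOlshanskiSpherical, h.isPositiveDefinite hb⟩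

end OlshanskiMotion

end

open OlshanskiMotion in
theorem theorem4p8 (q : ℕ) (hq : 1 ≤ q) :
    (({φ : GInf ℝ q → ℂ | IsOlshanskiSpherical φ ∧ IsPositiveDefinite φ} =
        {φ : GInf ℝ q → ℂ | ∃ b ∈ posCone ℝ q, Represents φ (psi b)}) ∧
      ∀ b ∈ posCone ℝ q, ∃! φ : GInf ℝ q → ℂ, Represents φ (psi b)) ∧
    (({φ : GInf ℂ q → ℂ | IsOlshanskiSpherical φ ∧ IsPositiveDefinite φ} =
        {φ : GInf ℂ q → ℂ | ∃ b ∈ posCone ℂ q, Represents φ (psi b)}) ∧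
      ∀ b ∈ posCone ℂ q, ∃! φ : GInf ℂ q → ℂ, Represents φ (psi b)) ∧
    (({φ : GInf (Quaternion ℝ) q → ℂ | IsOlshanskiSpherical φ ∧ IsPositiveDefinite φ} =
        {φ : GInf (Quaternion ℝ) q → ℂ |
          ∃ b ∈ posCone (Quaternion ℝ) q, Represents φ (psi b)}) ∧
      ∀ b ∈ posCone (Quaternion ℝ) q,
        ∃! φ : GInf (Quaternion ℝ) q → ℂ, Represents φ (psi b)) := by
  exact ⟨positiveDefinite_spherical_classification ℝ q,
    positiveDefinite_spherical_classification ℂ q,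
    positiveDefinite_spherical_classification (Quaternion ℝ) q⟩
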